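/- Let $\mathbb T^2=\mathbb R^2/\mathbb Z^2$, and for $f\in L^2(\mathbb T^2)$ let $\widehat f(n)=\int_{[0,1]^2}e^{-2\pi i x\cdot n}f(x)\,dx$, $n\in\mathbb Z^2$. For $\alpha=(\alpha_1,\alpha_2)$ put $Q(n)=\alpha_1n_1^2+\alpha_2n_2^2$ and $$(e^{it\Delta}f)(x)=\sum_{n\in\mathbb Z^2}\widehat f(n)\,e^{2\pi i(n\cdot x+Q(n)t)}$$ (the Schrödinger evolution of a flat, possibly irrational, torus, rescaled to $\mathbb T^2$). For $\mathcal S\subseteq\mathbb Z^2$ let $P_{\mathcal S}$ be the Fourier multiplier on $L^2(\mathbb T^2)$ whose symbol is the characteristic function of $\mathcal S$. For real $N\ge1$ let $\mathscr C_N$ (the "cubes of size $N$") be the collection of all $\mathcal C\subseteq\mathbb Z^2$ for which there exist $z\in\mathbb Z^2$ and an orthogonal $2\times2$ matrix $O$ with $O\mathcal C+z\subseteq[-N,N]^2$. Let $C>0$, let $2<p\le4$, and let $\tau_0\subseteq[0,1]$ be an interval. Then there is a constant $c>0$, depending only on $C$, $p$ and $\tau_0$, such that for all $\alpha_1,\alpha_2\in(1/C,C)$,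 all real $N\ge M\ge1$, all $\mathcal C_1\in\mathscr C_N$ and $\mathcal C_2,\mathcal C_3\in\mathscr C_M$, and all $\phi_1,\phi_2,\phi_3\in L^2(\mathbb T^2)$, $$\Bigl\|\prod_{j=1}^3P_{\mathcal C_j}e^{it\Delta}\phi_j\Bigr\|_{L^p(\tau_0,L^2(\mathbb T^2))}\le c\,M^{2-\frac2p}\prod_{j=1}^3\|P_{\mathcal C_j}\phi_j\|_{L^2(\mathbb T^2)}.$$ -/

import Mathlib

open MeasureTheory UnitAddTorus
open scoped ENNReal

-- The measure on `ℝ / ℤ` used for Fourier series in Mathlib: Haar measure of total mass one.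
attribute [local instance] instMeasureSpaceUnitAddCircle

attribute [local instance] instIsAddHaarMeasureUnitAddCircleVolume

attribute [local instance] instIsProbabilityMeasureUnitAddCircleVolume

namespace IrrationalTorus

noncomputable section

/-- The space `L²(𝕋ᵈ)` of complex-valued functions on `𝕋ᵈ = ℝᵈ / ℤᵈ`. -/
abbrev L2 (d : ℕ) : Type := Lp ℂ 2 (volume : Measure (UnitAddTorus (Fin d)))

/-- The quadratic form `Q(n) = α₁ n₁² + … + α_d n_d²`. -/
def Q {d : ℕ} (α : Fin d → ℝ) (n : Fin d → ℤ) : ℝ := ∑ i, α i * (n i : ℝ) ^ 2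

/-- The Fourier multiplier with symbol `m`: the `L²`-convergent Fourier series
`∑ m(n) f̂(n) e^{2πi n·x}`. It is used for bounded symbols only. -/
def fourierMultiplier {d : ℕ} (m : (Fin d → ℤ) → ℂ) (f : L2 d) : L2 d :=
  ∑' n, (m n * mFourierCoeff f n) • mFourierLp 2 n

/-- The frequency projection `P_S`, i.e. the Fourier multiplier whose symbol is the
characteristic function of `S ⊆ ℤᵈ`. -/
def freqProj {d : ℕ} (S : Set (Fin d → ℤ)) : L2 d → L2 d :=
  fourierMultiplier (S.indicator fun _ => 1)

/-- The linear Schrödinger evolution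
`(e^{itΔ} f)(x) = ∑ f̂(n) e^{2πi (n·x + Q(n) t)}`. -/
def schrodinger {d : ℕ} (α : Fin d → ℝ) (t : ℝ) : L2 d → L2 d :=
  fourierMultiplier fun n => Complex.exp (2 * Real.pi * Complex.I * (Q α n * t : ℝ))

/-- The collection `𝓡_{N,M}` of all sets `𝒞 ⊆ ℤᵈ` for which there are `z ∈ ℤᵈ` and an orthogonal
`d × d` matrix `O` with `O 𝒞 + z ⊆ [-N, N]^{d-1} × [-M, M]`. -/
def rectangles (d : ℕ) (N M : ℝ) : Set (Set (Fin d → ℤ)) :=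
  {𝒞 | ∃ z : Fin d → ℤ, ∃ O ∈ Matrix.orthogonalGroup (Fin d) ℝ, ∀ n ∈ 𝒞, ∀ i : Fin d,
    |O.mulVec (fun j => (n j : ℝ)) i + (z i : ℝ)| ≤ if (i : ℕ) + 1 = d then M else N}

/-- The collection `𝓒_N = 𝓡_{N,N}` of (subsets of rotated and translated) cubes of size `N`. -/
def cubes (d : ℕ) (N : ℝ) : Set (Set (Fin d → ℤ)) := rectangles d N N

/-- The mixed norm `‖F‖_{L^p(τ, L²(𝕋ᵈ))}`, with values in `[0, ∞]`. -/
def mixedNorm {d : ℕ} (p : ℝ≥0∞) (τ : Set ℝ) (F : ℝ → UnitAddTorus (Fin d) → ℂ) : ℝ≥0∞ :=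
  eLpNorm (fun t => eLpNorm (F t) 2 volume) p (volume.restrict τ)

/-- For a bounded symbol the series that defines the Fourier multiplier converges in `L²`. -/
theorem hasSum_fourierMultiplier {d : ℕ} {m : (Fin d → ℤ) → ℂ} {B : ℝ} (hm : ∀ n, ‖m n‖ ≤ B)
    (f : L2 d) :
    HasSum (fun n => (m n * mFourierCoeff f n) • mFourierLp 2 n) (fourierMultiplier m f) := by
  have hmem : Memℓp (fun n => m n * mFourierCoeff f n) 2 := by
    rw [memℓp_gen_iff (by norm_num)]
    have hs := (hasSum_sq_mFourierCoeff f).summable.mul_left (B ^ 2)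
    refine hs.of_nonneg_of_le (fun n => by positivity) (fun n => ?_)
    simp only [ENNReal.toReal_ofNat, Real.rpow_ofNat, norm_mul, mul_pow]
    gcongr
    exact hm n
  have h := (mFourierBasis (d := Fin d)).hasSum_repr_symm ⟨_, hmem⟩
  rw [coe_mFourierBasis] at h
  exact h.summable.hasSum

/-- The Fourier coefficients of a Fourier multiplier with bounded symbol. -/
theorem mFourierCoeff_fourierMultiplier {d : ℕ} {m : (Fin d → ℤ) → ℂ} {B : ℝ}
    (hm : ∀ n, ‖m n‖ ≤ B) (f : L2 d) (n : Fin d → ℤ) :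
    mFourierCoeff (fourierMultiplier m f) n = m n * mFourierCoeff f n := by
  have h := (hasSum_fourierMultiplier hm f).mapL
    (innerSL ℂ (mFourierLp (d := Fin d) 2 n))
  have key : ∀ k, innerSL ℂ (mFourierLp (d := Fin d) 2 n)
      ((m k * mFourierCoeff f k) • mFourierLp 2 k) =
      if k = n then m n * mFourierCoeff f n else 0 := by
    intro k
    rw [innerSL_apply_apply, inner_smul_right,
      orthonormal_iff_ite.mp (orthonormal_mFourier (d := Fin d)) n k]
    by_cases hk : n = k
    · subst hk; simp
    · simp [hk, Ne.symm hk]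
  simp_rw [key] at h
  have h2 := h.unique (hasSum_ite_eq n (m n * mFourierCoeff f n))
  rw [← mFourierBasis_repr, HilbertBasis.repr_apply_apply, coe_mFourierBasis, ← h2,
    innerSL_apply_apply]

end

end IrrationalTorus

/-! Expand the product in space: its coefficient at an output frequency `k` is an exponential sum in
`t` over pairs `z = (z₁, z₂)` from the two small cubes, the frequency in the large cube being `k -
z₁ - z₂`. Parseval in `x` and Minkowski in `ℓ²` (as `p ≥ 2`) reduce the theorem to an `L^p` bound in
time for each such sum, uniform in `k`. The `ℓ²` masses of the coefficients then add up over `k` to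
exactly the product of the three `L²` masses, so the size `N` never enters.

For fixed `k`, duality (`sq_eLpNorm_expi_sum_le`) bounds the squared `L^p` norm by the `ℓ²` mass
times the `L^{p/2}` norm of a kernel `∑ e(λ t)` over any larger index set. In the variables `z₁ -
z₂` and `z₁ + z₂` the phase decouples into four one-variable quadratics. Over a full box of side `2
^ J ≈ M` the kernel is therefore a product of four Weyl sums. Hölder asks for the `L^{2p}` norm of
each, and `2p > 4` lies above the critical exponent of quadratic Weyl sums. Hence each has norm `≲
M^{1 - 1/p}` without a logarithm, and the kernel has norm `≲ M^{4 - 4/p}`, the square of the desired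
constant.

The Weyl bound must be uniform in the linear phase, which depends on `k` and on the positions of the
cubes. Weyl differencing removes that phase and leaves counts of multiples `hτ` close to an integer
(`sq_norm_weyl_sum_le_weylMajorant`). A large count forces a small `q` with `qτ` extremely close to
an integer (`exists_mul_mem_nearInt`), which happens on a set of small measure. Summing over scales
gives geometric series that converge because `p > 2` (`eLpNorm_weylMajorant_le`). -/

namespace IrrationalTorus

noncomputable section

/-! ### The character `x ↦ e^{2πix}` -/

/-- The character `x ↦ e^{2πix}` of the real line. -/
def expi (x : ℝ) : ℂ := Complex.exp (2 * Real.pi * Complex.I * x)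

lemma expi_add (x y : ℝ) : expi (x + y) = expi x * expi y := by
  simp only [expi, ← Complex.exp_add]; congr 1; push_cast; ring

@[simp] lemma expi_zero : expi 0 = 1 := by simp [expi]

lemma expi_eq (x : ℝ) : expi x = Complex.exp (((2 * Real.pi * x : ℝ) : ℂ) * Complex.I) := by
  rw [expi]; congr 1; push_cast; ring

@[simp] lemma norm_expi (x : ℝ) : ‖expi x‖ = 1 := by
  rw [expi_eq, Complex.norm_exp_ofReal_mul_I]

lemma expi_natCast_mul (n : ℕ) (x : ℝ) : expi (n * x) = expi x ^ n := by
  simp only [expi, ← Complex.exp_nat_mul]; congr 1; push_cast; ring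

lemma conj_expi (x : ℝ) : (starRingEnd ℂ) (expi x) = expi (-x) := by
  rw [expi_eq, expi_eq, ← Complex.exp_conj]
  congr 1
  rw [map_mul, Complex.conj_ofReal, Complex.conj_I]
  push_cast; ring

@[fun_prop] lemma continuous_expi : Continuous expi := by unfold expi; fun_prop

lemma expi_intCast (m : ℤ) : expi m = 1 := by
  rw [expi, Complex.exp_eq_one_iff]
  exact ⟨m, by push_cast; ring⟩

/-! ### Distance to the integers and geometric sums -/

/-- The set of reals at distance less than `ε` from the integers. -/
def nearInt (ε : ℝ) : Set ℝ := {x | ∃ m : ℤ, |x - m| < ε}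

lemma isOpen_nearInt (ε : ℝ) : IsOpen (nearInt ε) := by
  have : nearInt ε = ⋃ m : ℤ, {x : ℝ | |x - m| < ε} := by ext; simp [nearInt]
  rw [this]
  exact isOpen_iUnion fun m => isOpen_lt (by fun_prop) continuous_const

lemma nearInt_sub {ε x y : ℝ} (hx : x ∈ nearInt ε) (hy : y ∈ nearInt ε) :
    x - y ∈ nearInt (2 * ε) := by
  obtain ⟨m, hm⟩ := hx
  obtain ⟨n, hn⟩ := hy
  refine ⟨m - n, ?_⟩
  rw [abs_lt] at *
  push_cast
  constructor <;> linarith [hm.1, hm.2, hn.1, hn.2]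

lemma le_norm_expi_sub_one (x : ℝ) : 4 * |x - round x| ≤ ‖expi x - 1‖ := by
  have h1 : expi x = Complex.exp (Complex.I * ((2 * Real.pi * (x - round x) : ℝ) : ℂ)) := by
    have : expi x = expi (x - round x) := by
      have := expi_add (x - round x) (round x : ℤ)
      rw [expi_intCast, mul_one, sub_add_cancel] at this
      exact this
    rw [this, expi_eq, mul_comm]
  rw [h1, Complex.norm_exp_I_mul_ofReal_sub_one]
  have h2 := abs_sub_round x
  set y := x - round x
  have h3 : |Real.pi * y| ≤ Real.pi / 2 := by
    rw [abs_mul, abs_of_pos Real.pi_pos]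
    nlinarith [Real.pi_pos]
  have h4 := Real.mul_abs_le_abs_sin h3
  rw [abs_mul, abs_of_pos Real.pi_pos, ← mul_assoc, div_mul_cancel₀ _ Real.pi_pos.ne'] at h4
  rw [show 2 * Real.pi * y / 2 = Real.pi * y by ring, Real.norm_eq_abs, abs_mul,
    abs_of_pos (by norm_num : (0 : ℝ) < 2)]
  linarith

lemma norm_sum_expi_le_card {ι : Type*} (s : Finset ι) (f : ι → ℝ) :
    ‖∑ n ∈ s, expi (f n)‖ ≤ s.card := by
  refine (norm_sum_le _ _).trans ?_
  simp

lemma norm_geom_sum_expi_le {δ x : ℝ} (hδ : 0 < δ) (hx : x ∉ nearInt δ) (K : ℕ) :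
    ‖∑ n ∈ Finset.range K, expi (n * x)‖ ≤ 1 / (2 * δ) := by
  have hr : δ ≤ |x - round x| := by
    by_contra! h
    exact hx ⟨_, h⟩
  have h1 := le_norm_expi_sub_one x
  have h2 : ‖expi x - 1‖ * ‖∑ n ∈ Finset.range K, expi (n * x)‖ ≤ 2 := by
    simp_rw [expi_natCast_mul]
    rw [← norm_mul, mul_geom_sum]
    refine (norm_sub_le _ _).trans ?_
    simp only [norm_pow, norm_expi, one_pow, norm_one]
    norm_num
  rw [le_div_iff₀ (by positivity)]
  have h3 : 4 * δ ≤ ‖expi x - 1‖ := by linarith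
  nlinarith [norm_nonneg (∑ n ∈ Finset.range K, expi (n * x))]

/-- Take the largest `i ≤ J` with `x` within `2⁻ⁱ` of an integer. If `i = J` the trivial bound
suffices; otherwise the distance is at least `2⁻⁽ⁱ⁺¹⁾` and the geometric sum is at most `2ⁱ`.
Indicators are used so that summation over multiples of a number yields counts. -/
lemma norm_geom_sum_expi_le_dyadic {J K : ℕ} (hK : K ≤ 2 ^ J) (x : ℝ) :
    ‖∑ n ∈ Finset.range K, expi (n * x)‖ ≤
      ∑ i ∈ Finset.range (J + 1), (nearInt (1 / 2 ^ i)).indicator (fun _ => (2 : ℝ) ^ i) x := by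
  classical
  have key : ∃ i ≤ J, x ∈ nearInt (1 / 2 ^ i) ∧
      ‖∑ n ∈ Finset.range K, expi (n * x)‖ ≤ 2 ^ i := by
    have h0 : x ∈ nearInt (1 / 2 ^ 0) :=
      ⟨round x, by have := abs_sub_round x; norm_num; linarith⟩
    set i := Nat.findGreatest (fun i => x ∈ nearInt (1 / 2 ^ i)) J with hi
    have hi1 : x ∈ nearInt (1 / 2 ^ i) :=
      Nat.findGreatest_spec (P := fun i => x ∈ nearInt (1 / 2 ^ i)) (Nat.zero_le J) h0
    have hiJ : i ≤ J := Nat.findGreatest_le J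
    refine ⟨i, hiJ, hi1, ?_⟩
    rcases hiJ.eq_or_lt with h | h
    · refine (norm_sum_expi_le_card _ _).trans ?_
      rw [Finset.card_range, h]
      exact_mod_cast hK
    · have h2 : x ∉ nearInt (1 / 2 ^ (i + 1)) :=
        Nat.findGreatest_is_greatest (P := fun i => x ∈ nearInt (1 / 2 ^ i))
          (Nat.lt_succ_self i) h
      refine (norm_geom_sum_expi_le (by positivity) h2 K).trans (le_of_eq ?_)
      rw [pow_succ]; field_simp
  obtain ⟨i, hi, hx, hb⟩ := key
  refine hb.trans ?_
  have := Finset.single_le_sum (f := fun i => (nearInt (1 / 2 ^ i)).indicator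
    (fun _ => (2 : ℝ) ^ i) x) (s := Finset.range (J + 1))
    (fun j _ => Set.indicator_nonneg (fun _ _ => by positivity) _)
    (Finset.mem_range.2 (Nat.lt_succ_of_le hi))
  rwa [Set.indicator_of_mem hx] at this

/-! ### Weyl differencing -/

lemma sum_range_sum_range_eq_sum_diff {E : Type*} [AddCommMonoid E] (f : ℕ → ℕ → E) (L : ℕ) :
    ∑ n ∈ Finset.range L, ∑ m ∈ Finset.range n, f n m =
      ∑ h ∈ Finset.Ico 1 L, ∑ m ∈ Finset.range (L - h), f (m + h) m := by
  rw [Finset.sum_sigma', Finset.sum_sigma']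
  refine Finset.sum_bij' (fun x _ => ⟨x.1 - x.2, x.2⟩) (fun x _ => ⟨x.2 + x.1, x.2⟩) ?_ ?_ ?_ ?_ ?_
  · rintro ⟨a, b⟩ h; simp at h ⊢; omega
  · rintro ⟨a, b⟩ h; simp at h ⊢; omega
  · rintro ⟨a, b⟩ h; simp at h ⊢; omega
  · rintro ⟨a, b⟩ h; simp at h ⊢
  · rintro ⟨a, b⟩ h
    simp at h ⊢
    congr 1; omega

lemma sq_norm_sum_range_eq (a : ℕ → ℂ) (L : ℕ) :
    ‖∑ n ∈ Finset.range L, a n‖ ^ 2 = ∑ n ∈ Finset.range L, ‖a n‖ ^ 2 +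
      2 * (∑ n ∈ Finset.range L, ∑ m ∈ Finset.range n, a n * (starRingEnd ℂ) (a m)).re := by
  induction L with
  | zero => simp
  | succ L ih =>
    rw [Finset.sum_range_succ, Finset.sum_range_succ _ L, Finset.sum_range_succ _ L,
      Complex.sq_norm, Complex.normSq_add, ← Complex.sq_norm, ← Complex.sq_norm, ih,
      Complex.add_re, ← Finset.mul_sum, ← map_sum]
    have : (∑ n ∈ Finset.range L, a n) * (starRingEnd ℂ) (a L) =
      (starRingEnd ℂ) (a L * (starRingEnd ℂ) (∑ n ∈ Finset.range L, a n)) := by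
      simp [mul_comm]
    rw [this, Complex.conj_re]
    ring

lemma sq_norm_sum_range_le (a : ℕ → ℂ) (L : ℕ) :
    ‖∑ n ∈ Finset.range L, a n‖ ^ 2 ≤ ∑ n ∈ Finset.range L, ‖a n‖ ^ 2 +
      2 * ∑ h ∈ Finset.Ico 1 L,
        ‖∑ m ∈ Finset.range (L - h), a (m + h) * (starRingEnd ℂ) (a m)‖ := by
  rw [sq_norm_sum_range_eq, sum_range_sum_range_eq_sum_diff]
  gcongr
  exact (Complex.re_le_norm _).trans (norm_sum_le _ _)

/-- After differencing, `ξ` survives only in a factor independent of the summation variable, of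
modulus one; this makes every later bound uniform in `ξ`. -/
lemma sq_norm_weyl_sum_le (θ ξ : ℝ) (L : ℕ) :
    ‖∑ n ∈ Finset.range L, expi (θ * n ^ 2 + ξ * n)‖ ^ 2 ≤
      L + 2 * ∑ h ∈ Finset.Ico 1 L, ‖∑ n ∈ Finset.range (L - h), expi (n * (h * (2 * θ)))‖ := by
  refine (sq_norm_sum_range_le _ L).trans (le_of_eq ?_)
  congr 1
  · simp
  · congr 1
    refine Finset.sum_congr rfl fun h _ => ?_
    have : ∀ m : ℕ, expi (θ * ((m + h : ℕ) : ℝ) ^ 2 + ξ * ((m + h : ℕ) : ℝ)) *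
        (starRingEnd ℂ) (expi (θ * m ^ 2 + ξ * m)) =
        expi (θ * h ^ 2 + ξ * h) * expi (m * (h * (2 * θ))) := by
      intro m
      rw [conj_expi, ← expi_add, ← expi_add]
      congr 1; push_cast; ring
    simp_rw [this]
    rw [← Finset.mul_sum, norm_mul, norm_expi, one_mul]

/-! ### Small multiples -/

open Classical in
/-- The multiples `hτ`, `1 ≤ h < H`, that lie within `ε` of an integer. -/
def closeMultiples (H : ℕ) (ε τ : ℝ) : Finset ℕ :=
  {h ∈ Finset.Ico 1 H | (h : ℝ) * τ ∈ nearInt ε}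

lemma mem_closeMultiples {H : ℕ} {ε τ : ℝ} {h : ℕ} :
    h ∈ closeMultiples H ε τ ↔ (1 ≤ h ∧ h < H) ∧ (h : ℝ) * τ ∈ nearInt ε := by
  simp [closeMultiples]

lemma card_closeMultiples_le (H : ℕ) (ε τ : ℝ) : (closeMultiples H ε τ).card ≤ H := by
  classical
  refine (Finset.card_filter_le _ _).trans ?_
  simp

lemma card_closeMultiples_eq_sum (H : ℕ) (ε τ : ℝ) : ((closeMultiples H ε τ).card : ℝ) =
    ∑ h ∈ Finset.Ico 1 H, (nearInt ε).indicator (fun _ => (1 : ℝ)) (h * τ) := by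
  classical
  rw [closeMultiples, Finset.card_filter]
  push_cast
  exact Finset.sum_congr rfl fun h _ => by simp [Set.indicator_apply]

lemma measurable_card_closeMultiples (H : ℕ) (ε : ℝ) :
    Measurable fun τ => ((closeMultiples H ε τ).card : ℝ) := by
  simp_rw [card_closeMultiples_eq_sum]
  refine Finset.measurable_sum _ fun h _ => ?_
  exact (measurable_const.indicator (isOpen_nearInt ε).measurableSet).comp
    (measurable_const.mul measurable_id)

/-- Cut the range into `B` blocks of length `H`. Within a block, subtracting the smallest close
multiple leaves multiples `hτ` with `h < H`, at the cost of doubling `ε`. -/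
lemma card_closeMultiples_le_blocks (B H : ℕ) (hH : 0 < H) (ε τ : ℝ) :
    (closeMultiples (B * H) ε τ).card ≤ (1 + (closeMultiples H (2 * ε) τ).card) * B := by
  classical
  have hf : ∀ a ∈ closeMultiples (B * H) ε τ, a / H ∈ Finset.range B := by
    intro a ha
    rw [mem_closeMultiples] at ha
    rw [Finset.mem_range, Nat.div_lt_iff_lt_mul hH]
    exact ha.1.2
  have := Finset.card_le_mul_card_image_of_maps_to hf (1 + (closeMultiples H (2 * ε) τ).card) ?_
  · simpa using this
  intro b _
  rcases ({a ∈ closeMultiples (B * H) ε τ | a / H = b}).eq_empty_or_nonempty with h | h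
  · rw [h]; simp
  obtain ⟨h₀, h₀m, hmin⟩ := Finset.exists_minimal h
  have hsub : {a ∈ closeMultiples (B * H) ε τ | a / H = b} ⊆
      insert h₀ ((closeMultiples H (2 * ε) τ).image (· + h₀)) := by
    intro a ha
    rw [Finset.mem_insert, Finset.mem_image]
    rcases eq_or_ne a h₀ with rfl | hne
    · exact Or.inl rfl
    right
    have hle : h₀ ≤ a := by
      rcases le_total h₀ a with h | h
      · exact h
      · exact hmin ha h
    rw [Finset.mem_filter, mem_closeMultiples] at ha h₀m
    refine ⟨a - h₀, ?_, by omega⟩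
    rw [mem_closeMultiples]
    refine ⟨⟨by omega, ?_⟩, ?_⟩
    · have h1 := Nat.div_add_mod a H
      have h2 := Nat.div_add_mod h₀ H
      have h3 := Nat.mod_lt a hH
      rw [ha.2] at h1
      rw [h₀m.2] at h2
      omega
    · rw [Nat.cast_sub hle, sub_mul]
      exact nearInt_sub ha.1.2 h₀m.1.2
  refine (Finset.card_le_card hsub).trans ((Finset.card_insert_le _ _).trans ?_)
  have := Finset.card_image_le (s := closeMultiples H (2 * ε) τ) (f := (· + h₀))
  omega

/-- If many multiples are close to an integer then they are all multiples of a single one that is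
very close to an integer. -/
lemma exists_mul_mem_nearInt {H : ℕ} {τ : ℝ} {l : ℕ} (hl : 1 ≤ l)
    (hc : l ≤ (closeMultiples H (1 / (2 * H)) τ).card) :
    ∃ q : ℕ, 1 ≤ q ∧ q * l ≤ H ∧ (q : ℝ) * τ ∈ nearInt (1 / (2 * (H * l))) := by
  classical
  set E := closeMultiples H (1 / (2 * H)) τ with hE
  have hne : E.Nonempty := Finset.card_pos.1 (by omega)
  have hmem : ∀ h ∈ E, (1 ≤ h ∧ h < H) ∧ ∃ m : ℤ, |(h : ℝ) * τ - m| < 1 / (2 * H) :=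
    fun h hh => mem_closeMultiples.1 hh
  obtain ⟨s, hs, hmax⟩ := E.exists_max_image id hne
  obtain ⟨⟨hs1, hsH⟩, m, hm⟩ := hmem s hs
  have hH : (0 : ℝ) < H := by exact_mod_cast (by omega : 0 < H)
  -- The integer `h m - s m'` has absolute value below `1`, so it vanishes: all pairs (multiple,
  -- nearest integer) lie on one line through the origin.
  have hcol : ∀ h ∈ E, (s : ℤ) ∣ h * m := by
    intro h hh
    obtain ⟨⟨hh1, hhH⟩, m', hm'⟩ := hmem h hh
    have hlt : |((h * m - s * m' : ℤ) : ℝ)| < 1 := by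
      have e1 : ((h * m - s * m' : ℤ) : ℝ) =
          s * ((h : ℝ) * τ - m') - h * ((s : ℝ) * τ - m) := by push_cast; ring
      rw [e1]
      refine (abs_sub _ _).trans_lt ?_
      rw [abs_mul, abs_mul, Nat.abs_cast, Nat.abs_cast]
      have hsr : (s : ℝ) ≤ H := by exact_mod_cast hsH.le
      have hhr : (h : ℝ) ≤ H := by exact_mod_cast hhH.le
      have b1 : (s : ℝ) * |(h : ℝ) * τ - m'| ≤ H * |(h : ℝ) * τ - m'| := by gcongr
      have b2 : (h : ℝ) * |(s : ℝ) * τ - m| ≤ H * |(s : ℝ) * τ - m| := by gcongr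
      have b3 : (H : ℝ) * |(h : ℝ) * τ - m'| < H * (1 / (2 * H)) := by gcongr
      have b4 : (H : ℝ) * |(s : ℝ) * τ - m| < H * (1 / (2 * H)) := by gcongr
      have b5 : (H : ℝ) * (1 / (2 * H)) = 1 / 2 := by field_simp
      linarith
    have h0 : (h * m - s * m' : ℤ) = 0 := by
      rw [← Int.abs_lt_one_iff]
      exact_mod_cast hlt
    exact ⟨m', by linarith⟩
  set g := Nat.gcd s m.natAbs with hg
  have hgpos : 0 < g := Nat.gcd_pos_of_pos_left _ hs1
  obtain ⟨q, hq⟩ := Nat.gcd_dvd_left s m.natAbs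
  rw [← hg] at hq
  have hgm : (g : ℤ) ∣ m := Int.natCast_dvd.2 (Nat.gcd_dvd_right s m.natAbs)
  obtain ⟨a, ha⟩ := hgm
  have hqpos : 0 < q := by
    rcases Nat.eq_zero_or_pos q with h | h
    · rw [h] at hq; omega
    · exact h
  -- The line has reduced slope `a / q`, where `s = g q` and `m = g a`.
  have hdvd : ∀ h ∈ E, q ∣ h := by
    intro h hh
    have h1 : s ∣ h * m.natAbs := by
      have := hcol h hh
      rw [← Int.natCast_dvd_natCast]
      push_cast
      rw [← dvd_abs] at this
      simpa [abs_mul] using this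
    have h2 : s ∣ h * g := by
      rw [hg, ← Nat.gcd_mul_left]
      exact Nat.dvd_gcd (dvd_mul_left _ _) h1
    rw [hq, mul_comm h g] at h2
    exact Nat.dvd_of_mul_dvd_mul_left hgpos h2
  have hcard : E.card ≤ g := by
    have : E ⊆ (Finset.Icc 1 g).image (q * ·) := by
      intro h hh
      obtain ⟨k, hk⟩ := hdvd h hh
      rw [Finset.mem_image]
      refine ⟨k, ?_, hk.symm⟩
      have h1 := (hmem h hh).1.1
      have h2 : h ≤ s := hmax h hh
      rw [Finset.mem_Icc]
      constructor
      · rcases Nat.eq_zero_or_pos k with h | h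
        · rw [h] at hk; omega
        · exact h
      · rw [hk, hq, mul_comm g q] at h2
        exact Nat.le_of_mul_le_mul_left h2 hqpos
    refine (Finset.card_le_card this).trans (Finset.card_image_le.trans ?_)
    simp
  have hlg : l ≤ g := hc.trans hcard
  refine ⟨q, hqpos, ?_, a, ?_⟩
  · calc q * l ≤ q * g := Nat.mul_le_mul_left _ hlg
      _ = s := by rw [hq, mul_comm]
      _ ≤ H := hsH.le
  -- The error of `s` is `g` times that of `q`, which gains the factor `g ≥ l`.
  · have hgr : (0 : ℝ) < g := by exact_mod_cast hgpos
    have hlr : (0 : ℝ) < l := by exact_mod_cast hl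
    have e1 : (s : ℝ) * τ - m = g * ((q : ℝ) * τ - a) := by
      rw [hq, ha]; push_cast; ring
    rw [e1, abs_mul, Nat.abs_cast] at hm
    have hlg' : (l : ℝ) ≤ g := by exact_mod_cast hlg
    have b1 : (l : ℝ) * |(q : ℝ) * τ - a| < 1 / (2 * H) :=
      (mul_le_mul_of_nonneg_right hlg' (abs_nonneg _)).trans_lt hm
    rw [show 1 / (2 * ((H : ℝ) * l)) = 1 / (2 * H) / l by field_simp, lt_div_iff₀ hlr]
    linarith

/-! ### The Weyl majorant -/

/-- A majorant, uniform in the linear phase, for the square of a quadratic Weyl sum of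
length `2 ^ J`. -/
def weylMajorant (J : ℕ) (τ : ℝ) : ℝ :=
  8 * 2 ^ J * ∑ i ∈ Finset.range (J + 1),
    (2 + ((closeMultiples (2 ^ (i - 2)) (1 / (2 * (2 ^ (i - 2) : ℕ))) τ).card : ℝ))

lemma weylMajorant_nonneg (J : ℕ) (τ : ℝ) : 0 ≤ weylMajorant J τ := by
  unfold weylMajorant; positivity

lemma measurable_weylMajorant (J : ℕ) : Measurable (weylMajorant J) := by
  unfold weylMajorant
  exact measurable_const.mul (Finset.measurable_sum _ fun i _ =>
    measurable_const.add (measurable_card_closeMultiples _ _))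

/-- Blocks of length `H = 2^(i-2)` are chosen so that the doubled tolerance `2 · 2⁻ⁱ` equals `1 /
(2H)`, the threshold at which `exists_mul_mem_nearInt` applies. -/
lemma two_pow_mul_card_closeMultiples_le {i J : ℕ} (hi : i ≤ J) (τ : ℝ) :
    (2 : ℝ) ^ i * (closeMultiples (2 ^ J) (1 / 2 ^ i) τ).card ≤
      4 * 2 ^ J *
        (1 + (closeMultiples (2 ^ (i - 2)) (1 / (2 * (2 ^ (i - 2) : ℕ))) τ).card) := by
  have h1 := card_closeMultiples_le_blocks (2 ^ (J - (i - 2))) (2 ^ (i - 2)) (by positivity)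
    (1 / 2 ^ i) τ
  rw [← pow_add, Nat.sub_add_cancel (by omega)] at h1
  have h2 : (closeMultiples (2 ^ (i - 2)) (2 * (1 / 2 ^ i)) τ).card ≤
      (closeMultiples (2 ^ (i - 2)) (1 / (2 * (2 ^ (i - 2) : ℕ))) τ).card := by
    -- For `i < 2` the truncated exponent gives blocks of length one, and there is no `h` with `1 ≤
    -- h < 1`.
    rcases lt_or_ge i 2 with h | h
    · rw [Nat.sub_eq_zero_of_le h.le]
      simp [closeMultiples]
    · obtain ⟨k, rfl⟩ := Nat.exists_eq_add_of_le' h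
      rw [show 2 * (1 / (2 : ℝ) ^ (k + 2)) = 1 / (2 * (2 ^ (k + 2 - 2) : ℕ)) by
        rw [Nat.add_sub_cancel, pow_add]; push_cast; field_simp]
  have h3 : (2 : ℝ) ^ i * 2 ^ (J - (i - 2)) ≤ 4 * 2 ^ J := by
    rw [← pow_add, show (4 : ℝ) = 2 ^ 2 by norm_num, ← pow_add]
    exact pow_le_pow_right₀ (by norm_num) (by omega)
  have h4 : ((closeMultiples (2 ^ J) (1 / 2 ^ i) τ).card : ℝ) ≤
      (1 + (closeMultiples (2 ^ (i - 2)) (1 / (2 * (2 ^ (i - 2) : ℕ))) τ).card) *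
        2 ^ (J - (i - 2)) := by
    exact_mod_cast h1.trans (Nat.mul_le_mul_right _ (Nat.add_le_add_left h2 1))
  calc _ ≤ (2 : ℝ) ^ i * ((1 + (closeMultiples (2 ^ (i - 2))
        (1 / (2 * (2 ^ (i - 2) : ℕ))) τ).card) * 2 ^ (J - (i - 2))) := by gcongr
    _ = ((2 : ℝ) ^ i * 2 ^ (J - (i - 2))) * (1 + (closeMultiples (2 ^ (i - 2))
        (1 / (2 * (2 ^ (i - 2) : ℕ))) τ).card) := by ring
    _ ≤ _ := by gcongr

theorem sq_norm_weyl_sum_le_weylMajorant (J : ℕ) (θ ξ : ℝ) :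
    ‖∑ n ∈ Finset.range (2 ^ J), expi (θ * n ^ 2 + ξ * n)‖ ^ 2 ≤ weylMajorant J (2 * θ) := by
  refine (sq_norm_weyl_sum_le θ ξ _).trans ?_
  have h1 : ∑ h ∈ Finset.Ico 1 (2 ^ J),
      ‖∑ n ∈ Finset.range (2 ^ J - h), expi (n * (h * (2 * θ)))‖ ≤
      ∑ i ∈ Finset.range (J + 1),
        (2 : ℝ) ^ i * (closeMultiples (2 ^ J) (1 / 2 ^ i) (2 * θ)).card := by
    refine (Finset.sum_le_sum fun h _ =>
      norm_geom_sum_expi_le_dyadic (Nat.sub_le _ h) (h * (2 * θ))).trans (le_of_eq ?_)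
    rw [Finset.sum_comm]
    refine Finset.sum_congr rfl fun i _ => ?_
    rw [card_closeMultiples_eq_sum, Finset.mul_sum]
    refine Finset.sum_congr rfl fun h _ => ?_
    classical
    simp only [Set.indicator_apply, mul_ite, mul_one, mul_zero]
  have h2 : ∑ i ∈ Finset.range (J + 1),
        (2 : ℝ) ^ i * (closeMultiples (2 ^ J) (1 / 2 ^ i) (2 * θ)).card ≤
      ∑ i ∈ Finset.range (J + 1), 4 * 2 ^ J *
        (1 + ((closeMultiples (2 ^ (i - 2)) (1 / (2 * (2 ^ (i - 2) : ℕ))) (2 * θ)).card : ℝ)) :=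
    Finset.sum_le_sum fun i hi =>
      two_pow_mul_card_closeMultiples_le (Nat.lt_succ_iff.1 (Finset.mem_range.1 hi)) _
  -- The `2` in the majorant, against the `1` in `h2`, absorbs the diagonal term `2 ^ J`.
  rw [weylMajorant]
  simp only [Finset.sum_add_distrib, ← Finset.mul_sum, Finset.sum_const, Finset.card_range,
    nsmul_eq_mul] at h2 ⊢
  push_cast at h1 h2 ⊢
  nlinarith [pow_pos (two_pos : (0 : ℝ) < 2) J, (Nat.cast_nonneg J : (0 : ℝ) ≤ J),
    mul_nonneg (pow_pos (two_pos : (0 : ℝ) < 2) J).le (Nat.cast_nonneg J : (0 : ℝ) ≤ J)]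

/-! ### Moments of the Weyl majorant -/

/-- At most `2γ + 2` integers `m` are relevant, each contributing an interval of length `2ε / γ`. -/
lemma volume_preimage_nearInt_le {γ ε : ℝ} (hγ : 0 < γ) (hε : 0 < ε) (hε' : ε ≤ 1 / 2) :
    volume.restrict (Set.Icc (-1 : ℝ) 1) {t | γ * t ∈ nearInt ε} ≤
      ENNReal.ofReal (4 * ε * (1 + 1 / γ)) := by
  have hms : MeasurableSet {t | γ * t ∈ nearInt ε} :=
    ((isOpen_nearInt ε).preimage (continuous_const.mul continuous_id)).measurableSet
  rw [Measure.restrict_apply hms]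
  set k := ⌊γ + 1 / 2⌋₊ with hk
  have hsub : {t | γ * t ∈ nearInt ε} ∩ Set.Icc (-1 : ℝ) 1 ⊆
      ⋃ m ∈ Finset.Icc (-k : ℤ) k, Metric.ball ((m : ℝ) / γ) (ε / γ) := by
    rintro t ⟨⟨m, hm⟩, ht1, ht2⟩
    rw [Set.mem_iUnion₂]
    have habs : |(m : ℝ)| ≤ γ + 1 / 2 := by
      rw [abs_lt] at hm
      rw [abs_le]
      constructor <;> nlinarith
    refine ⟨m, ?_, ?_⟩
    · have : m.natAbs ≤ k := by
        refine Nat.le_floor ?_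
        rwa [Nat.cast_natAbs, Int.cast_abs]
      rw [Finset.mem_Icc]
      omega
    · rw [Metric.mem_ball, Real.dist_eq, lt_div_iff₀ hγ,
        show t - m / γ = (γ * t - m) / γ by field_simp, abs_div, abs_of_pos hγ,
        div_mul_cancel₀ _ hγ.ne']
      exact hm
  refine (measure_mono hsub).trans ((measure_biUnion_finset_le _ _).trans ?_)
  simp only [Real.volume_ball, Finset.sum_const, Int.card_Icc, nsmul_eq_mul]
  rw [← ENNReal.ofReal_natCast, ← ENNReal.ofReal_mul (by positivity)]
  refine ENNReal.ofReal_le_ofReal ?_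
  have hk' : (k : ℝ) ≤ γ + 1 / 2 := Nat.floor_le (by positivity)
  have e1 : (((k : ℤ) + 1 - (-k : ℤ)).toNat : ℝ) = 2 * k + 1 := by
    have : ((k : ℤ) + 1 - (-k : ℤ)).toNat = 2 * k + 1 := by omega
    rw [this]; push_cast; ring
  rw [e1]
  calc (2 * (k : ℝ) + 1) * (2 * (ε / γ)) ≤ (2 * (γ + 1 / 2) + 1) * (2 * (ε / γ)) := by gcongr
    _ = _ := by field_simp; ring

lemma sum_range_pow_le {x : ℝ} (hx : 1 < x) (n : ℕ) :
    ∑ j ∈ Finset.range n, x ^ j ≤ x ^ n / (x - 1) := by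
  rw [geom_sum_eq hx.ne']
  have : 0 < x - 1 := by linarith
  gcongr
  linarith

/-- If the count lies in `[2^j, 2^(j+1))`, then `exists_mul_mem_nearInt` with `l = 2^j` supplies one
of the pairs `(j, q)` on the right. -/
lemma card_closeMultiples_rpow_le {p : ℝ} (hp : 0 < p) (k : ℕ) (τ : ℝ) :
    ((closeMultiples (2 ^ k) (1 / (2 * (2 ^ k : ℕ))) τ).card : ℝ≥0∞) ^ p ≤
      ∑ j ∈ Finset.range (k + 1), ∑ q ∈ Finset.Icc (1 : ℕ) (2 ^ (k - j)),
        {σ | (q : ℝ) * σ ∈ nearInt (1 / (2 * (2 ^ k * 2 ^ j)))}.indicator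
          (fun _ => ENNReal.ofReal (((2 : ℝ) ^ p) ^ (j + 1))) τ := by
  set E := closeMultiples (2 ^ k) (1 / (2 * (2 ^ k : ℕ))) τ with hE
  rcases Nat.eq_zero_or_pos E.card with h0 | hpos
  · rw [h0, Nat.cast_zero, ENNReal.zero_rpow_of_pos hp]
    exact zero_le
  set j := Nat.log 2 E.card with hj
  have hj1 : 2 ^ j ≤ E.card := Nat.pow_log_le_self 2 hpos.ne'
  have hj2 : E.card ≤ 2 ^ (j + 1) := (Nat.lt_pow_succ_log_self (by norm_num) _).le
  obtain ⟨q, hq1, hq2, hq3⟩ := exists_mul_mem_nearInt (Nat.one_le_two_pow (n := j)) hj1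
  have hjk : j ≤ k := by
    have : 2 ^ j ≤ 2 ^ k := hj1.trans (card_closeMultiples_le _ _ _)
    exact (Nat.pow_le_pow_iff_right (by norm_num)).1 this
  have hqk : q ≤ 2 ^ (k - j) := by
    rw [← Nat.sub_add_cancel hjk, pow_add] at hq2
    simpa using Nat.le_of_mul_le_mul_right hq2 (by positivity)
  have hb : (E.card : ℝ≥0∞) ^ p ≤ ENNReal.ofReal (((2 : ℝ) ^ p) ^ (j + 1)) := by
    rw [← ENNReal.ofReal_natCast, ENNReal.ofReal_rpow_of_nonneg (by positivity) hp.le]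
    refine ENNReal.ofReal_le_ofReal ?_
    rw [← Real.rpow_natCast ((2 : ℝ) ^ p), ← Real.rpow_mul (by norm_num), mul_comm,
      Real.rpow_mul (by norm_num), Real.rpow_natCast]
    exact Real.rpow_le_rpow (by positivity) (by exact_mod_cast hj2) hp.le
  refine hb.trans ?_
  refine le_trans ?_ (Finset.single_le_sum (f := fun j => ∑ q ∈ Finset.Icc (1 : ℕ) (2 ^ (k - j)),
        {σ | (q : ℝ) * σ ∈ nearInt (1 / (2 * (2 ^ k * 2 ^ j)))}.indicator
          (fun _ => ENNReal.ofReal (((2 : ℝ) ^ p) ^ (j + 1))) τ) (fun _ _ => zero_le)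
          (Finset.mem_range.2 (Nat.lt_succ_of_le hjk)))
  refine le_trans ?_ (Finset.single_le_sum (f := fun q : ℕ =>
        {σ | (q : ℝ) * σ ∈ nearInt (1 / (2 * (2 ^ k * 2 ^ j)))}.indicator
          (fun _ => ENNReal.ofReal (((2 : ℝ) ^ p) ^ (j + 1))) τ) (fun _ _ => zero_le)
          (Finset.mem_Icc.2 ⟨hq1, hqk⟩))
  rw [Set.indicator_of_mem]
  simpa using hq3

lemma lintegral_card_closeMultiples_rpow_le {p β : ℝ} (hp : 2 < p) (hβ : 0 < β) (k : ℕ) :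
    ∫⁻ t in Set.Icc (-1 : ℝ) 1,
      ((closeMultiples (2 ^ k) (1 / (2 * (2 ^ k : ℕ))) (β * t)).card : ℝ≥0∞) ^ p ≤
    ENNReal.ofReal (2 ^ p * 2 * (1 + 1 / β) * ((2 : ℝ) ^ (p - 2) / ((2 : ℝ) ^ (p - 2) - 1)) *
      ((2 : ℝ) ^ (p - 2)) ^ k) := by
  have hms : ∀ (q : ℕ) (ε : ℝ), MeasurableSet {t | (q : ℝ) * (β * t) ∈ nearInt ε} := fun q ε =>
    ((isOpen_nearInt ε).preimage (by fun_prop : Continuous fun t : ℝ => (q : ℝ) * (β * t))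
      ).measurableSet
  have hx : (1 : ℝ) < 2 ^ (p - 2) := Real.one_lt_rpow (by norm_num) (by linarith)
  refine (lintegral_mono fun t => card_closeMultiples_rpow_le (by linarith) k (β * t)).trans ?_
  have hind : ∀ (q : ℕ) (ε : ℝ) (A : ℝ≥0∞) (t : ℝ),
      {σ | (q : ℝ) * σ ∈ nearInt ε}.indicator (fun _ => A) (β * t) =
      {t | (q : ℝ) * (β * t) ∈ nearInt ε}.indicator (fun _ => A) t := fun _ _ _ _ => rfl
  simp_rw [hind]
  rw [lintegral_finsetSum _ fun j _ => Finset.measurable_sum _ fun q _ =>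
    measurable_const.indicator (hms _ _)]
  have hj : ∀ j ∈ Finset.range (k + 1), ∫⁻ t in Set.Icc (-1 : ℝ) 1,
      ∑ q ∈ Finset.Icc (1 : ℕ) (2 ^ (k - j)),
        {t | (q : ℝ) * (β * t) ∈ nearInt (1 / (2 * (2 ^ k * 2 ^ j)))}.indicator
          (fun _ => ENNReal.ofReal (((2 : ℝ) ^ p) ^ (j + 1))) t ≤
      ENNReal.ofReal (2 ^ p * 2 * (1 + 1 / β) * ((2 : ℝ) ^ (p - 2)) ^ j) := by
    intro j hj
    have hjk : j ≤ k := Nat.lt_succ_iff.1 (Finset.mem_range.1 hj)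
    rw [lintegral_finsetSum _ fun q _ => measurable_const.indicator (hms _ _)]
    have hq : ∀ q ∈ Finset.Icc (1 : ℕ) (2 ^ (k - j)), ∫⁻ t in Set.Icc (-1 : ℝ) 1,
        {t | (q : ℝ) * (β * t) ∈ nearInt (1 / (2 * (2 ^ k * 2 ^ j)))}.indicator
          (fun _ => ENNReal.ofReal (((2 : ℝ) ^ p) ^ (j + 1))) t ≤
        ENNReal.ofReal (((2 : ℝ) ^ p) ^ (j + 1) *
          (4 * (1 / (2 * (2 ^ k * 2 ^ j))) * (1 + 1 / β))) := by
      intro q hq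
      have hq1 : (1 : ℝ) ≤ q := by exact_mod_cast (Finset.mem_Icc.1 hq).1
      rw [lintegral_indicator_const (hms _ _), ENNReal.ofReal_mul (by positivity)]
      gcongr
      have := volume_preimage_nearInt_le (γ := q * β) (ε := 1 / (2 * (2 ^ k * 2 ^ j)))
        (by positivity) (by positivity) (by
          have : (1 : ℝ) ≤ 2 ^ k * 2 ^ j := by
            rw [← pow_add]; exact one_le_pow₀ (by norm_num)
          gcongr; linarith)
      simp_rw [mul_assoc] at this ⊢
      refine this.trans (ENNReal.ofReal_le_ofReal ?_)
      gcongr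
      nlinarith
    refine (Finset.sum_le_card_nsmul _ _ _ hq).trans ?_
    rw [nsmul_eq_mul, Nat.card_Icc, Nat.add_sub_cancel, ← ENNReal.ofReal_natCast,
      ← ENNReal.ofReal_mul (by positivity)]
    -- There are `2^(k-j)` values of `q`, each of measure about `2^(-k-j)`, with weight
    -- `2^(p(j+1))`: the total is about `2^((p-2)j)`, growing in `j` because `p > 2`.
    refine ENNReal.ofReal_le_ofReal (le_of_eq ?_)
    have e1 : (2 : ℝ) ^ k = 2 ^ (k - j) * 2 ^ j := by rw [← pow_add, Nat.sub_add_cancel hjk]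
    have e2 : (2 : ℝ) ^ (p - 2) = 2 ^ p / 4 := by
      rw [Real.rpow_sub (by norm_num)]; norm_num
    rw [e1, e2, pow_succ, div_pow, show (4 : ℝ) = 2 ^ 2 by norm_num, ← pow_mul, mul_comm 2 j,
      pow_mul]
    push_cast
    field_simp
  refine (Finset.sum_le_sum hj).trans ?_
  rw [← ENNReal.ofReal_sum_of_nonneg fun _ _ => by positivity, ← Finset.mul_sum]
  refine ENNReal.ofReal_le_ofReal ?_
  have := sum_range_pow_le hx (k + 1)
  calc _ ≤ 2 ^ p * 2 * (1 + 1 / β) * (((2 : ℝ) ^ (p - 2)) ^ (k + 1) / ((2 : ℝ) ^ (p - 2) - 1)) := by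
        gcongr
    _ = _ := by rw [pow_succ]; ring

lemma eLpNorm_card_closeMultiples_le {p b : ℝ} (hp : 2 < p) (hb : 0 < b) :
    ∃ c : ℝ, 0 < c ∧ ∀ (k : ℕ) (β : ℝ), b ≤ β →
      eLpNorm (fun t => ((closeMultiples (2 ^ k) (1 / (2 * (2 ^ k : ℕ))) (β * t)).card : ℝ))
        (ENNReal.ofReal p) (volume.restrict (Set.Icc (-1 : ℝ) 1)) ≤
      ENNReal.ofReal (c * ((2 : ℝ) ^ (1 - 2 / p)) ^ k) := by
  have hx : (1 : ℝ) < 2 ^ (p - 2) := Real.one_lt_rpow (by norm_num) (by linarith)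
  have hx' : (0 : ℝ) < 2 ^ (p - 2) - 1 := by linarith
  have hp0 : 0 < p := by linarith
  set A : ℝ := 2 ^ p * 2 * (1 + 1 / b) * ((2 : ℝ) ^ (p - 2) / ((2 : ℝ) ^ (p - 2) - 1)) with hA
  have hApos : 0 < A := by positivity
  refine ⟨A ^ (1 / p), by positivity, fun k β hβ => ?_⟩
  have hβ0 : 0 < β := hb.trans_le hβ
  rw [eLpNorm_eq_lintegral_rpow_enorm_toReal (by simpa using hp0) ENNReal.ofReal_ne_top,
    ENNReal.toReal_ofReal hp0.le]
  simp_rw [Real.enorm_natCast]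
  refine (ENNReal.rpow_le_rpow (lintegral_card_closeMultiples_rpow_le hp hβ0 k)
    (by positivity)).trans ?_
  rw [ENNReal.ofReal_rpow_of_nonneg (by positivity) (by positivity)]
  refine ENNReal.ofReal_le_ofReal ?_
  have e1 : (((2 : ℝ) ^ (p - 2)) ^ k) ^ (1 / p) = ((2 : ℝ) ^ (1 - 2 / p)) ^ k := by
    rw [← Real.rpow_natCast, ← Real.rpow_natCast, ← Real.rpow_mul (by positivity), ← Real.rpow_mul (by norm_num), ← Real.rpow_mul (by norm_num)]
    congr 1; field_simp
  rw [← e1, ← Real.mul_rpow (by positivity) (by positivity), hA]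
  gcongr

/-- The scales `i` contribute a geometric series of ratio `2^(1 - 2/p) > 1`, dominated by `i = J`;
thus no factor `J`, that is, no logarithm, is lost. -/
theorem eLpNorm_weylMajorant_le {p b : ℝ} (hp : 2 < p) (hb : 0 < b) :
    ∃ c : ℝ, 0 < c ∧ ∀ (J : ℕ) (β : ℝ), b ≤ β →
      eLpNorm (fun t => weylMajorant J (β * t)) (ENNReal.ofReal p)
        (volume.restrict (Set.Icc (-1 : ℝ) 1)) ≤
      ENNReal.ofReal (c * ((2 : ℝ) ^ J) ^ (2 - 2 / p)) := by
  obtain ⟨c, hc, hcard⟩ := eLpNorm_card_closeMultiples_le hp hb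
  have hp0 : 0 < p := by linarith
  have hγ : 0 < 1 - 2 / p := by
    rw [sub_pos, div_lt_one hp0]; exact hp
  set y : ℝ := (2 : ℝ) ^ (1 - 2 / p) with hy
  have hy1 : 1 < y := Real.one_lt_rpow (by norm_num) hγ
  have hy' : 0 < y - 1 := by linarith
  set μ := volume.restrict (Set.Icc (-1 : ℝ) 1) with hμ
  have h1p : 1 ≤ ENNReal.ofReal p := by
    rw [← ENNReal.ofReal_one]; exact ENNReal.ofReal_le_ofReal (by linarith)
  refine ⟨8 * ((4 + c) * (y / (y - 1))), by positivity, fun J β hβ => ?_⟩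
  have hterm : ∀ i ∈ Finset.range (J + 1), eLpNorm (fun t =>
      (2 + ((closeMultiples (2 ^ (i - 2)) (1 / (2 * (2 ^ (i - 2) : ℕ))) (β * t)).card : ℝ)))
      (ENNReal.ofReal p) μ ≤ ENNReal.ofReal ((4 + c) * y ^ i) := by
    intro i _
    have hm := ((measurable_card_closeMultiples (2 ^ (i - 2)) (1 / (2 * (2 ^ (i - 2) : ℕ)))).comp
      (measurable_const_mul β)).aestronglyMeasurable (μ := μ)
    refine (eLpNorm_add_le (f := fun _ => (2 : ℝ)) aestronglyMeasurable_const hm h1p).trans ?_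
    rw [add_mul, ENNReal.ofReal_add (by positivity) (by positivity)]
    refine add_le_add ?_ ((hcard (i - 2) β hβ).trans (ENNReal.ofReal_le_ofReal ?_))
    · rw [eLpNorm_const' _ (by simpa using hp0) ENNReal.ofReal_ne_top,
        ENNReal.toReal_ofReal hp0.le, hμ, Measure.restrict_apply_univ, Real.volume_Icc,
        ENNReal.ofReal_rpow_of_nonneg (by norm_num) (by positivity), Real.enorm_eq_ofReal
        (by norm_num), ← ENNReal.ofReal_mul (by norm_num)]
      refine ENNReal.ofReal_le_ofReal ?_
      have h2 : ((1 : ℝ) - -1) ^ (1 / p) ≤ 2 := by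
        rw [show (1 : ℝ) - -1 = 2 by norm_num]
        refine (Real.rpow_le_rpow_of_exponent_le (by norm_num) ?_).trans_eq (Real.rpow_one 2)
        rw [div_le_one hp0]; linarith
      have h3 : 1 ≤ y ^ i := one_le_pow₀ hy1.le
      linarith
    · gcongr
      · exact hy1.le
      · omega
  have hsum : (fun t => weylMajorant J (β * t)) = (8 * 2 ^ J : ℝ) •
      ∑ i ∈ Finset.range (J + 1), fun t : ℝ =>
        (2 + ((closeMultiples (2 ^ (i - 2)) (1 / (2 * (2 ^ (i - 2) : ℕ))) (β * t)).card : ℝ)) := by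
    ext t
    simp [weylMajorant]
  rw [hsum, eLpNorm_const_smul, Real.enorm_eq_ofReal (by positivity)]
  have hS := (eLpNorm_sum_le (fun i _ => ((measurable_const.add
    ((measurable_card_closeMultiples (2 ^ (i - 2)) (1 / (2 * (2 ^ (i - 2) : ℕ)))).comp
      (measurable_const_mul β))).aestronglyMeasurable (μ := μ))) h1p).trans
        (Finset.sum_le_sum hterm)
  rw [← ENNReal.ofReal_sum_of_nonneg fun _ _ => by positivity, ← Finset.mul_sum] at hS
  refine (mul_le_mul_right hS _).trans ?_
  rw [← ENNReal.ofReal_mul (by positivity)]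
  refine ENNReal.ofReal_le_ofReal ?_
  have e1 : ((2 : ℝ) ^ J) ^ (2 - 2 / p) = 2 ^ J * y ^ J := by
    rw [hy, show (2 - 2 / p) = 1 + (1 - 2 / p) by ring, Real.rpow_add (by positivity),
      Real.rpow_one, ← Real.rpow_natCast, ← Real.rpow_natCast, ← Real.rpow_mul (by norm_num),
      ← Real.rpow_mul (by norm_num), mul_comm (J : ℝ)]
  calc _ ≤ 8 * 2 ^ J * ((4 + c) * (y ^ (J + 1) / (y - 1))) := by
        gcongr; exact sum_range_pow_le hy1 _
    _ = _ := by rw [e1, pow_succ]; ring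

/-! ### A convolution inequality on the unit interval -/

lemma lintegral_Icc_sub_left_le (κ : ℝ → ℝ≥0∞) {t : ℝ} (ht : t ∈ Set.Icc (0 : ℝ) 1) :
    ∫⁻ s in Set.Icc (0 : ℝ) 1, κ (t - s) ≤ ∫⁻ u in Set.Icc (-1 : ℝ) 1, κ u := by
  rw [← lintegral_indicator measurableSet_Icc, ← lintegral_indicator measurableSet_Icc,
    ← lintegral_sub_left_eq_self ((Set.Icc (-1 : ℝ) 1).indicator κ) t]
  refine lintegral_mono fun s => ?_
  by_cases hs : s ∈ Set.Icc (0 : ℝ) 1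
  · have : t - s ∈ Set.Icc (-1 : ℝ) 1 := by
      constructor <;> linarith [hs.1, hs.2, ht.1, ht.2]
    rw [Set.indicator_of_mem hs, Set.indicator_of_mem this]
  · rw [Set.indicator_of_notMem hs]; exact zero_le

lemma lintegral_Icc_sub_right_le (κ : ℝ → ℝ≥0∞) {s : ℝ} (hs : s ∈ Set.Icc (0 : ℝ) 1) :
    ∫⁻ t in Set.Icc (0 : ℝ) 1, κ (t - s) ≤ ∫⁻ u in Set.Icc (-1 : ℝ) 1, κ u := by
  rw [← lintegral_indicator measurableSet_Icc, ← lintegral_indicator measurableSet_Icc,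
    ← lintegral_sub_right_eq_self ((Set.Icc (-1 : ℝ) 1).indicator κ) s]
  refine lintegral_mono fun t => ?_
  by_cases ht : t ∈ Set.Icc (0 : ℝ) 1
  · have : t - s ∈ Set.Icc (-1 : ℝ) 1 := by
      constructor <;> linarith [hs.1, hs.2, ht.1, ht.2]
    rw [Set.indicator_of_mem ht, Set.indicator_of_mem this]
  · rw [Set.indicator_of_notMem ht]; exact zero_le

/-- Young's inequality for the bilinear form `∫∫ g(t) g(s) k(t - s)` on the unit square. -/
theorem lintegral_lintegral_conv_le {p : ℝ} (hp : 2 ≤ p) {f κ : ℝ → ℝ≥0∞} (hf : Measurable f)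
    (hκ : Measurable κ) :
    ∫⁻ t in Set.Icc (0 : ℝ) 1, ∫⁻ s in Set.Icc (0 : ℝ) 1,
        f t ^ (1 - 1 / p) * f s ^ (1 - 1 / p) * κ (t - s) ^ (2 / p) ≤
      (∫⁻ t in Set.Icc (0 : ℝ) 1, f t) ^ (2 - 2 / p) *
        (∫⁻ u in Set.Icc (-1 : ℝ) 1, κ u) ^ (2 / p) := by
  have hp0 : 0 < p := by linarith
  have h2p : 0 ≤ 1 - 2 / p := by rw [sub_nonneg, div_le_one hp0]; exact hp
  set μ := volume.restrict (Set.Icc (0 : ℝ) 1) with hμ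
  set X := ∫⁻ t, f t ∂μ with hX
  set Y := ∫⁻ u in Set.Icc (-1 : ℝ) 1, κ u with hY
  have m1 : Measurable fun z : ℝ × ℝ => f z.1 := hf.comp measurable_fst
  have m2 : Measurable fun z : ℝ × ℝ => f z.2 := hf.comp measurable_snd
  have m3 : Measurable fun z : ℝ × ℝ => κ (z.1 - z.2) :=
    hκ.comp (measurable_fst.sub measurable_snd)
  rw [lintegral_lintegral (f := fun t s => f t ^ (1 - 1 / p) * f s ^ (1 - 1 / p) *
    κ (t - s) ^ (2 / p)) (((m1.pow_const _).mul (m2.pow_const _)).mul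
      (m3.pow_const _)).aemeasurable]
  -- Three-function Hölder with weights `1/p`, `1/p`, `1 - 2/p`. The first two integrals are at most
  -- `X * Y`, since `t - s` stays in `[-1, 1]`; the third equals `X * X`.
  let G : Fin 3 → ℝ × ℝ → ℝ≥0∞ :=
    ![fun z => f z.1 * κ (z.1 - z.2), fun z => f z.2 * κ (z.1 - z.2), fun z => f z.1 * f z.2]
  let w : Fin 3 → ℝ := ![1 / p, 1 / p, 1 - 2 / p]
  have hol := ENNReal.lintegral_prod_norm_pow_le (μ := μ.prod μ) Finset.univ (f := G) (p := w)
    (by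
      intro i _
      fin_cases i
      · exact (m1.mul m3).aemeasurable
      · exact (m2.mul m3).aemeasurable
      · exact (m1.mul m2).aemeasurable)
    (by simp only [w, Fin.sum_univ_three, Matrix.cons_val]; ring)
    (by
      intro i _
      fin_cases i
      · exact (by positivity : 0 ≤ 1 / p)
      · exact (by positivity : 0 ≤ 1 / p)
      · exact h2p)
  have e0 : ∀ z : ℝ × ℝ, f z.1 ^ (1 - 1 / p) * f z.2 ^ (1 - 1 / p) * κ (z.1 - z.2) ^ (2 / p) =
      ∏ i, G i z ^ w i := by
    intro z
    simp only [Fin.prod_univ_three, G, w, Matrix.cons_val]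
    rw [ENNReal.mul_rpow_of_nonneg _ _ (by positivity), ENNReal.mul_rpow_of_nonneg _ _
      (by positivity), ENNReal.mul_rpow_of_nonneg _ _ h2p,
      show 1 - 1 / p = 1 / p + (1 - 2 / p) by ring, show 2 / p = 1 / p + 1 / p by ring,
      ENNReal.rpow_add_of_nonneg _ _ (by positivity) (by rwa [← show 2 / p = 1 / p + 1 / p by ring]),
      ENNReal.rpow_add_of_nonneg _ _ (by positivity) (by rwa [← show 2 / p = 1 / p + 1 / p by ring]),
      ENNReal.rpow_add_of_nonneg _ _ (by positivity) (by positivity)]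
    ring
  simp_rw [e0]
  refine hol.trans ?_
  simp only [Fin.prod_univ_three, G, w, Matrix.cons_val]
  have i1 : ∫⁻ z, f z.1 * κ (z.1 - z.2) ∂(μ.prod μ) ≤ X * Y := by
    rw [lintegral_prod (fun z : ℝ × ℝ => f z.1 * κ (z.1 - z.2)) (m1.mul m3).aemeasurable, hX, ← lintegral_mul_const _ hf]
    refine setLIntegral_mono_ae' measurableSet_Icc (ae_of_all _ fun t ht => ?_)
    have hm : Measurable fun s => κ (t - s) := hκ.comp (measurable_const.sub measurable_id)
    dsimp only
    rw [lintegral_const_mul _ hm]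
    gcongr
    exact lintegral_Icc_sub_left_le κ ht
  have i2 : ∫⁻ z, f z.2 * κ (z.1 - z.2) ∂(μ.prod μ) ≤ X * Y := by
    rw [lintegral_prod_symm (fun z : ℝ × ℝ => f z.2 * κ (z.1 - z.2)) (m2.mul m3).aemeasurable, hX, ← lintegral_mul_const _ hf]
    refine setLIntegral_mono_ae' measurableSet_Icc (ae_of_all _ fun s hs => ?_)
    have hm : Measurable fun t => κ (t - s) := hκ.comp (measurable_id.sub measurable_const)
    dsimp only
    rw [lintegral_const_mul _ hm]
    gcongr
    exact lintegral_Icc_sub_right_le κ hs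
  have i3 : ∫⁻ z, f z.1 * f z.2 ∂(μ.prod μ) = X * X :=
    lintegral_prod_mul hf.aemeasurable hf.aemeasurable
  rw [i3]
  calc _ ≤ (X * Y) ^ (1 / p) * (X * Y) ^ (1 / p) * (X * X) ^ (1 - 2 / p) := by
        gcongr
    _ = X ^ (2 - 2 / p) * Y ^ (2 / p) := by
        rw [ENNReal.mul_rpow_of_nonneg _ _ (by positivity), ENNReal.mul_rpow_of_nonneg _ _ h2p,
          show 2 - 2 / p = (1 / p + 1 / p) + ((1 - 2 / p) + (1 - 2 / p)) by ring,
          show Y ^ (2 / p) = Y ^ (1 / p + 1 / p) by congr 1; ring,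
          ENNReal.rpow_add_of_nonneg (x := X) (1 / p + 1 / p) _ (by positivity) (by linarith),
          ENNReal.rpow_add_of_nonneg (x := X) (1 / p) (1 / p) (by positivity) (by positivity),
          ENNReal.rpow_add_of_nonneg (x := Y) (1 / p) (1 / p) (by positivity) (by positivity),
          ENNReal.rpow_add_of_nonneg (x := X) (1 - 2 / p) _ h2p h2p]
        ring

/-! ### Exponential sums with real frequencies: duality -/

lemma sum_sq_norm_integral_mul_expi {ι : Type*} (T : Finset ι) (lam : ι → ℝ) {g : ℝ → ℂ}
    (hg : Continuous g) :
    ((∑ m ∈ T, ‖∫ t in Set.Icc (0 : ℝ) 1, g t * expi (lam m * t)‖ ^ 2 : ℝ) : ℂ) =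
      ∫ t in Set.Icc (0 : ℝ) 1, g t * ∫ s in Set.Icc (0 : ℝ) 1,
        (starRingEnd ℂ) (g s) * ∑ m ∈ T, expi (lam m * (t - s)) := by
  have inner : ∀ t, ∫ s in Set.Icc (0 : ℝ) 1,
        (starRingEnd ℂ) (g s) * ∑ m ∈ T, expi (lam m * (t - s)) =
      ∑ m ∈ T, expi (lam m * t) *
        (starRingEnd ℂ) (∫ s in Set.Icc (0 : ℝ) 1, g s * expi (lam m * s)) := by
    intro t
    simp_rw [← integral_conj, ← integral_const_mul]
    rw [← integral_finsetSum]
    · refine integral_congr_ae (ae_of_all _ fun s => ?_)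
      simp only [Finset.mul_sum]
      refine Finset.sum_congr rfl fun m _ => ?_
      rw [map_mul, conj_expi, mul_sub, sub_eq_add_neg, expi_add]
      ring
    · intro m _
      refine Continuous.integrableOn_Icc ?_
      have := Complex.continuous_conj
      fun_prop
  simp_rw [inner, Finset.mul_sum]
  rw [integral_finsetSum]
  · push_cast
    refine Finset.sum_congr rfl fun m _ => ?_
    rw [← Complex.ofReal_pow, Complex.sq_norm, ← Complex.mul_conj, ← integral_mul_const]
    refine integral_congr_ae (ae_of_all _ fun t => ?_)
    simp only
    ring
  · intro m _
    refine Continuous.integrableOn_Icc ?_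
    fun_prop

/-- A `TT*` argument. Dualizing first turns the left side into a sum of squares, where passing from
`T` to the larger `T'` only adds nonnegative terms; the frequencies `lam` need no separation. -/
theorem sq_eLpNorm_expi_sum_le {ι ι' : Type*} {p : ℝ} (hp : 2 < p) (T : Finset ι)
    (T' : Finset ι') (φ : ι → ι') (hφ : Set.InjOn φ T) (hφ' : ∀ n ∈ T, φ n ∈ T') (c : ι → ℂ)
    (lam : ι' → ℝ) :
    eLpNorm (fun t => ∑ n ∈ T, c n * expi (lam (φ n) * t)) (ENNReal.ofReal p)
        (volume.restrict (Set.Icc (0 : ℝ) 1)) ^ 2 ≤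
      ENNReal.ofReal (∑ n ∈ T, ‖c n‖ ^ 2) *
        eLpNorm (fun t => ∑ m ∈ T', expi (lam m * t)) (ENNReal.ofReal (p / 2))
          (volume.restrict (Set.Icc (-1 : ℝ) 1)) := by
  classical
  have hp0 : 0 < p := by linarith
  set F : ℝ → ℂ := fun t => ∑ n ∈ T, c n * expi (lam (φ n) * t) with hF
  set K : ℝ → ℂ := fun t => ∑ m ∈ T', expi (lam m * t) with hK
  have hFc : Continuous F := by fun_prop
  have hKc : Continuous K := by fun_prop
  rw [eLpNorm_eq_lintegral_rpow_enorm_toReal (by simpa using hp0) ENNReal.ofReal_ne_top,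
    eLpNorm_eq_lintegral_rpow_enorm_toReal (by simpa using hp0) ENNReal.ofReal_ne_top,
    ENNReal.toReal_ofReal hp0.le, ENNReal.toReal_ofReal (by positivity)]
  set X := ∫⁻ t in Set.Icc (0 : ℝ) 1, ‖F t‖ₑ ^ p with hX
  set Y := ∫⁻ t in Set.Icc (-1 : ℝ) 1, ‖K t‖ₑ ^ (p / 2) with hY
  set D := ∑ n ∈ T, ‖c n‖ ^ 2 with hD
  -- The extremizer of `L^p` duality: `g F = |F|^p` and `|g| = (|F|^p)^(1 - 1/p)`.
  set g : ℝ → ℂ := fun t => (starRingEnd ℂ) (F t) * ((‖F t‖ ^ (p - 2) : ℝ) : ℂ) with hg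
  have hFpc : ∀ q : ℝ, 0 < q → Continuous fun t => ‖F t‖ ^ q := fun q hq =>
    hFc.norm.rpow_const fun _ => Or.inr hq.le
  have hgc : Continuous g :=
    (Complex.continuous_conj.comp hFc).mul (Complex.continuous_ofReal.comp (hFpc _ (by linarith)))
  have hgF : ∀ t, g t * F t = ((‖F t‖ ^ p : ℝ) : ℂ) := by
    intro t
    rw [hg]
    simp only
    rw [mul_right_comm, mul_comm ((starRingEnd ℂ) (F t)), Complex.mul_conj, ← Complex.sq_norm,
      ← Complex.ofReal_mul]
    congr 1
    rcases (norm_nonneg (F t)).eq_or_lt with h | h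
    · rw [← h, Real.zero_rpow hp0.ne']; simp
    · rw [← Real.rpow_natCast, ← Real.rpow_add h]; congr 1; push_cast; ring
  have hgn : ∀ t, ‖g t‖ₑ = (‖F t‖ₑ ^ p) ^ (1 - 1 / p) := by
    intro t
    rw [← ENNReal.rpow_mul, show p * (1 - 1 / p) = 1 + (p - 2) by field_simp; ring,
      ENNReal.rpow_add_of_nonneg _ _ (by norm_num) (by linarith), ENNReal.rpow_one, hg]
    simp only
    rw [enorm_mul, RCLike.enorm_conj]
    congr 1
    rw [← ofReal_norm, Complex.norm_real, Real.norm_of_nonneg (by positivity),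
      ← ENNReal.ofReal_rpow_of_nonneg (norm_nonneg _) (by linarith), ofReal_norm]
  set I : ι' → ℂ := fun m => ∫ t in Set.Icc (0 : ℝ) 1, g t * expi (lam m * t) with hI
  have hXreal : X = ENNReal.ofReal (∫ t in Set.Icc (0 : ℝ) 1, ‖F t‖ ^ p) := by
    rw [ofReal_integral_eq_lintegral_ofReal (hFpc p hp0).integrableOn_Icc
      (ae_of_all _ fun t => by positivity)]
    refine lintegral_congr fun t => ?_
    rw [← ENNReal.ofReal_rpow_of_nonneg (norm_nonneg _) hp0.le, ofReal_norm]
  have hXI : ((∫ t in Set.Icc (0 : ℝ) 1, ‖F t‖ ^ p : ℝ) : ℂ) = ∑ n ∈ T, c n * I (φ n) := by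
    rw [← integral_complex_ofReal]
    simp_rw [← hgF, hI, ← integral_const_mul]
    rw [← integral_finsetSum]
    · refine integral_congr_ae (ae_of_all _ fun t => ?_)
      simp only [hF, Finset.mul_sum]
      exact Finset.sum_congr rfl fun n _ => by ring
    · intro n _
      refine Continuous.integrableOn_Icc ?_
      fun_prop
  have hX2 : X ^ 2 ≤ ENNReal.ofReal D * ENNReal.ofReal (∑ m ∈ T', ‖I m‖ ^ 2) := by
    rw [hXreal, ← ENNReal.ofReal_pow (integral_nonneg fun t => by positivity),
      ← ENNReal.ofReal_mul (Finset.sum_nonneg fun _ _ => by positivity)]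
    refine ENNReal.ofReal_le_ofReal ?_
    have h1 : (∫ t in Set.Icc (0 : ℝ) 1, ‖F t‖ ^ p) ≤ ∑ n ∈ T, ‖c n‖ * ‖I (φ n)‖ := by
      refine (le_abs_self _).trans ?_
      rw [← Real.norm_eq_abs, ← Complex.norm_real, hXI]
      refine (norm_sum_le _ _).trans (le_of_eq ?_)
      simp
    have h2 : ∑ n ∈ T, ‖I (φ n)‖ ^ 2 ≤ ∑ m ∈ T', ‖I m‖ ^ 2 := by
      rw [← Finset.sum_image (f := fun m => ‖I m‖ ^ 2) (g := φ) hφ]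
      refine Finset.sum_le_sum_of_subset_of_nonneg ?_ fun _ _ _ => by positivity
      exact Finset.image_subset_iff.2 hφ'
    calc _ ≤ (∑ n ∈ T, ‖c n‖ * ‖I (φ n)‖) ^ 2 :=
          pow_le_pow_left₀ (integral_nonneg fun t => by positivity) h1 2
      _ ≤ D * ∑ n ∈ T, ‖I (φ n)‖ ^ 2 := Finset.sum_mul_sq_le_sq_mul_sq _ _ _
      _ ≤ _ := by gcongr
  have hI2 : ENNReal.ofReal (∑ m ∈ T', ‖I m‖ ^ 2) ≤ X ^ (2 - 2 / p) * Y ^ (2 / p) := by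
    have h0 : ENNReal.ofReal (∑ m ∈ T', ‖I m‖ ^ 2) =
        ‖((∑ m ∈ T', ‖I m‖ ^ 2 : ℝ) : ℂ)‖ₑ := by
      rw [← ofReal_norm, Complex.norm_real, Real.norm_of_nonneg (by positivity)]
    rw [h0, sum_sq_norm_integral_mul_expi T' lam hgc]
    refine (enorm_integral_le_lintegral_enorm _).trans ?_
    refine le_trans ?_ (lintegral_lintegral_conv_le hp.le
      (hFc.enorm.measurable.pow_const p) (hKc.enorm.measurable.pow_const (p / 2)))
    refine lintegral_mono fun t => ?_
    rw [enorm_mul (g t)]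
    refine (mul_le_mul_right (enorm_integral_le_lintegral_enorm _) _).trans ?_
    rw [← lintegral_const_mul']
    · refine lintegral_mono fun s => le_of_eq ?_
      rw [enorm_mul _ (∑ m ∈ T', _), RCLike.enorm_conj, hgn, hgn, ← mul_assoc]
      congr 1
      rw [← ENNReal.rpow_mul, show p / 2 * (2 / p) = 1 by field_simp, ENNReal.rpow_one]
    · exact enorm_ne_top
  have hXtop : X ≠ ⊤ := by rw [hXreal]; exact ENNReal.ofReal_ne_top
  -- Divide `X² ≤ D X^(2 - 2/p) Y^(2/p)` by the power of `X`, which is finite, and nonzero outside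
  -- the trivial case.
  have hfin : X ^ (2 / p) ≤ ENNReal.ofReal D * Y ^ (2 / p) := by
    rcases eq_or_ne X 0 with h0 | h0
    · rw [h0, ENNReal.zero_rpow_of_pos (by positivity)]; exact zero_le
    have h1 : X ^ (2 / p) * X ^ (2 - 2 / p) ≤
        ENNReal.ofReal D * Y ^ (2 / p) * X ^ (2 - 2 / p) := by
      rw [← ENNReal.rpow_add _ _ h0 hXtop, show 2 / p + (2 - 2 / p) = (2 : ℕ) by push_cast; ring,
        ENNReal.rpow_natCast]
      calc X ^ 2 ≤ _ := hX2
        _ ≤ ENNReal.ofReal D * (X ^ (2 - 2 / p) * Y ^ (2 / p)) := by gcongr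
        _ = _ := by ring
    refine (ENNReal.mul_le_mul_iff_left ?_ ?_).1 h1
    · exact (ENNReal.rpow_pos (pos_iff_ne_zero.2 h0) hXtop).ne'
    · refine ENNReal.rpow_ne_top_of_nonneg ?_ hXtop
      rw [sub_nonneg, div_le_iff₀ hp0]; linarith
  rw [← ENNReal.rpow_natCast, ← ENNReal.rpow_mul,
    show 1 / p * ((2 : ℕ) : ℝ) = 2 / p by push_cast; ring, show 1 / (p / 2) = 2 / p by field_simp]
  exact hfin

/-! ### The kernel: a product of four Weyl sums -/

lemma sum_piFinset_expi {κ : Type*} [Fintype κ] [DecidableEq κ] (s : κ → Finset ℕ)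
    (f : κ → ℕ → ℝ) :
    ∑ r ∈ Fintype.piFinset s, expi (∑ j, f j (r j)) = ∏ j, ∑ n ∈ s j, expi (f j n) := by
  rw [Finset.prod_univ_sum]
  refine Finset.sum_congr rfl fun r _ => ?_
  simp only [expi, ← Complex.exp_sum]
  congr 1
  push_cast
  rw [Finset.mul_sum]

/-- The sum over the box factors into four Weyl sums, and Hölder with weights `1/4` puts each in
`L^{2p}`, i.e. its square in `L^p`. The constants `η` only contribute unimodular factors. -/
theorem eLpNorm_weyl_kernel_le {p b : ℝ} (hp : 2 < p) (hb : 0 < b) :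
    ∃ c : ℝ, 0 < c ∧ ∀ (J : ℕ) (θ ξ η : Fin 2 × Bool → ℝ), (∀ j, b ≤ 2 * θ j) →
      eLpNorm (fun t => ∑ r ∈ Fintype.piFinset fun _ : Fin 2 × Bool => Finset.range (2 ^ J),
          expi ((∑ j, (θ j * (r j : ℝ) ^ 2 + ξ j * r j + η j)) * t))
        (ENNReal.ofReal (p / 2)) (volume.restrict (Set.Icc (-1 : ℝ) 1)) ≤
      ENNReal.ofReal (c * ((2 : ℝ) ^ J) ^ (4 - 4 / p)) := by
  obtain ⟨c, hc, hW⟩ := eLpNorm_weylMajorant_le hp hb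
  have hp0 : 0 < p := by linarith
  refine ⟨c ^ 2, by positivity, fun J θ ξ η hθ => ?_⟩
  set μ := volume.restrict (Set.Icc (-1 : ℝ) 1) with hμ
  have hpt : ∀ t, ‖∑ r ∈ Fintype.piFinset fun _ : Fin 2 × Bool => Finset.range (2 ^ J),
      expi ((∑ j, (θ j * (r j : ℝ) ^ 2 + ξ j * r j + η j)) * t)‖ₑ ^ (p / 2) ≤
      ∏ j, (‖weylMajorant J (2 * θ j * t)‖ₑ ^ p) ^ (1 / 4 : ℝ) := by
    intro t
    simp_rw [Finset.sum_mul]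
    rw [sum_piFinset_expi (fun _ => Finset.range (2 ^ J))
      (fun j n => (θ j * (n : ℝ) ^ 2 + ξ j * n + η j) * t), ← ofReal_norm, norm_prod,
      ENNReal.ofReal_prod_of_nonneg fun _ _ => norm_nonneg _,
      ← ENNReal.prod_rpow_of_nonneg (by positivity)]
    refine Finset.prod_le_prod' fun j _ => ?_
    have e1 : ‖∑ n ∈ Finset.range (2 ^ J), expi ((θ j * (n : ℝ) ^ 2 + ξ j * n + η j) * t)‖ =
        ‖∑ n ∈ Finset.range (2 ^ J), expi ((θ j * t) * (n : ℝ) ^ 2 + (ξ j * t) * n)‖ := by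
      have : ∀ n : ℕ, expi ((θ j * (n : ℝ) ^ 2 + ξ j * n + η j) * t) =
          expi ((θ j * t) * (n : ℝ) ^ 2 + (ξ j * t) * n) * expi (η j * t) := by
        intro n
        rw [← expi_add]; congr 1; ring
      simp_rw [this]
      rw [← Finset.sum_mul, norm_mul, norm_expi, mul_one]
    have e2 := sq_norm_weyl_sum_le_weylMajorant J (θ j * t) (ξ j * t)
    rw [← e1, ← mul_assoc] at e2
    rw [← ENNReal.rpow_mul, show p * (1 / 4) = p / 4 by ring, show p / 2 = (2 : ℕ) * (p / 4) by
      push_cast; ring, ENNReal.rpow_mul, ENNReal.rpow_natCast]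
    gcongr
    rw [Real.enorm_eq_ofReal (weylMajorant_nonneg _ _), ← ENNReal.ofReal_pow (norm_nonneg _)]
    exact ENNReal.ofReal_le_ofReal e2
  have hmeas : ∀ j, Measurable fun t => ‖weylMajorant J (2 * θ j * t)‖ₑ ^ p := fun j =>
    (((measurable_weylMajorant J).comp (measurable_const_mul _)).enorm).pow_const p
  have hol := ENNReal.lintegral_prod_norm_pow_le (μ := μ) Finset.univ
    (f := fun j t => ‖weylMajorant J (2 * θ j * t)‖ₑ ^ p) (p := fun _ : Fin 2 × Bool => (1 / 4 : ℝ))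
    (fun j _ => (hmeas j).aemeasurable) (by simp) (fun _ _ => by norm_num)
  rw [eLpNorm_eq_lintegral_rpow_enorm_toReal (by simpa using hp0) ENNReal.ofReal_ne_top,
    ENNReal.toReal_ofReal (by positivity)]
  refine (ENNReal.rpow_le_rpow ((lintegral_mono hpt).trans hol) (by positivity)).trans ?_
  rw [← ENNReal.prod_rpow_of_nonneg (by positivity)]
  have hj : ∀ j ∈ (Finset.univ : Finset (Fin 2 × Bool)),
      ((∫⁻ t, ‖weylMajorant J (2 * θ j * t)‖ₑ ^ p ∂μ) ^ (1 / 4 : ℝ)) ^ (1 / (p / 2)) ≤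
      ENNReal.ofReal ((c * ((2 : ℝ) ^ J) ^ (2 - 2 / p)) ^ (1 / 2 : ℝ)) := by
    intro j _
    have h := hW J (2 * θ j) (hθ j)
    rw [eLpNorm_eq_lintegral_rpow_enorm_toReal (by simpa using hp0) ENNReal.ofReal_ne_top,
      ENNReal.toReal_ofReal hp0.le] at h
    rw [← ENNReal.rpow_mul, show (1 / 4 : ℝ) * (1 / (p / 2)) = 1 / p * (1 / 2) by
      field_simp; norm_num, ENNReal.rpow_mul,
      ← ENNReal.ofReal_rpow_of_nonneg (by positivity) (by positivity)]
    gcongr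
  refine (Finset.prod_le_prod' hj).trans ?_
  rw [Finset.prod_const, ← ENNReal.ofReal_pow (by positivity)]
  refine ENNReal.ofReal_le_ofReal (le_of_eq ?_)
  have : (Finset.univ : Finset (Fin 2 × Bool)).card = 4 := rfl
  rw [this, ← Real.rpow_natCast, ← Real.rpow_mul (by positivity),
    show (1 / 2 : ℝ) * ((4 : ℕ) : ℝ) = (2 : ℕ) by push_cast; norm_num, Real.rpow_natCast, mul_pow]
  congr 1
  rw [← Real.rpow_natCast, ← Real.rpow_mul (by positivity)]
  congr 1; push_cast; ring

/-! ### Frequency cubes -/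

/-- Centre at a point of the set itself: rotated differences have coordinates at most `2N`, hence
length at most `2√2 N ≤ 3N`, and rotations preserve length. -/
lemma exists_center_of_mem_cubes {N : ℝ} (hN : 0 ≤ N) {𝒞 : Set (Fin 2 → ℤ)}
    (h𝒞 : 𝒞 ∈ cubes 2 N) :
    ∃ c : Fin 2 → ℤ, ∀ n ∈ 𝒞, ∀ i, |(n i : ℝ) - c i| ≤ 3 * N := by
  rcases 𝒞.eq_empty_or_nonempty with rfl | ⟨c, hc⟩
  · exact ⟨0, by simp⟩
  obtain ⟨z, O, hO, h⟩ := h𝒞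
  refine ⟨c, fun n hn i => ?_⟩
  rw [Matrix.mem_orthogonalGroup_iff'] at hO
  set v : Fin 2 → ℝ := (fun j => (n j : ℝ)) - fun j => (c j : ℝ) with hv
  have hcoord : ∀ j, |O.mulVec v j| ≤ 2 * N := by
    intro j
    have h1 := h n hn j
    have h2 := h c hc j
    rw [ite_self, abs_le] at h1 h2
    rw [hv, Matrix.mulVec_sub, Pi.sub_apply, abs_le]
    constructor <;> linarith [h1.1, h1.2, h2.1, h2.2]
  have hnorm : v 0 ^ 2 + v 1 ^ 2 = O.mulVec v 0 ^ 2 + O.mulVec v 1 ^ 2 := by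
    have h1 : O.mulVec v ⬝ᵥ O.mulVec v = v ⬝ᵥ v := by
      rw [Matrix.dotProduct_mulVec, Matrix.vecMul_mulVec, hO, Matrix.vecMul_one]
    simp only [dotProduct, Fin.sum_univ_two] at h1
    linarith
  have b0 := sq_le_sq' (abs_le.1 (hcoord 0)).1 (abs_le.1 (hcoord 0)).2
  have b1 := sq_le_sq' (abs_le.1 (hcoord 1)).1 (abs_le.1 (hcoord 1)).2
  have hsq : v i ^ 2 ≤ (3 * N) ^ 2 := by
    fin_cases i
    · change v 0 ^ 2 ≤ _
      nlinarith [sq_nonneg (v 1)]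
    · change v 1 ^ 2 ≤ _
      nlinarith [sq_nonneg (v 0)]
  exact abs_le_of_sq_le_sq hsq (by positivity)

lemma finite_of_mem_cubes {N : ℝ} (hN : 0 ≤ N) {𝒞 : Set (Fin 2 → ℤ)} (h𝒞 : 𝒞 ∈ cubes 2 N) :
    𝒞.Finite := by
  obtain ⟨c, hc⟩ := exists_center_of_mem_cubes hN h𝒞
  refine (Set.finite_Icc (c - fun _ => (⌈3 * N⌉ : ℤ)) (c + fun _ => (⌈3 * N⌉ : ℤ))).subset ?_
  intro n hn
  have key : ∀ i, |n i - c i| ≤ ⌈3 * N⌉ := fun i => by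
    have := (hc n hn i).trans (Int.le_ceil _)
    exact_mod_cast this
  rw [Set.mem_Icc]
  constructor <;> intro i <;> have := abs_le.1 (key i) <;>
    simp only [Pi.sub_apply, Pi.add_apply] <;> omega

/-! ### Trigonometric polynomials -/

lemma freqProj_coe_finset {d : ℕ} (S : Finset (Fin d → ℤ)) (f : L2 d) :
    freqProj (S : Set (Fin d → ℤ)) f = ∑ n ∈ S, mFourierCoeff f n • mFourierLp 2 n := by
  rw [freqProj, fourierMultiplier, tsum_eq_sum (s := S)]
  · exact Finset.sum_congr rfl fun n hn => by simp [hn]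
  · intro n hn
    simp [hn]

lemma mFourierCoeff_schrodinger {d : ℕ} (α : Fin d → ℝ) (t : ℝ) (f : L2 d) (n : Fin d → ℤ) :
    mFourierCoeff (schrodinger α t f) n = expi (Q α n * t) * mFourierCoeff f n :=
  mFourierCoeff_fourierMultiplier (B := 1) (fun k => (norm_expi (Q α k * t)).le) f n

lemma sum_smul_mFourierLp_ae_eq {d : ℕ} (S : Finset (Fin d → ℤ)) (a : (Fin d → ℤ) → ℂ) :
    (∑ n ∈ S, a n • mFourierLp 2 n : L2 d) =ᵐ[volume] fun x => ∑ n ∈ S, a n * mFourier n x := by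
  have : (∑ n ∈ S, a n • mFourierLp 2 n : L2 d) =
      ContinuousMap.toLp (E := ℂ) 2 volume ℂ (∑ n ∈ S, a n • mFourier n) := by
    simp [map_sum]
  rw [this]
  refine (ContinuousMap.coeFn_toLp volume _).trans (ae_of_all _ fun x => ?_)
  simp

lemma sq_norm_sum_smul_mFourierLp {d : ℕ} (S : Finset (Fin d → ℤ)) (a : (Fin d → ℤ) → ℂ) :
    ‖(∑ n ∈ S, a n • mFourierLp 2 n : L2 d)‖ ^ 2 = ∑ n ∈ S, ‖a n‖ ^ 2 := by
  have h := (orthonormal_mFourier (d := Fin d)).inner_sum a a S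
  rw [inner_self_eq_norm_sq_to_K] at h
  have h2 : ((‖(∑ n ∈ S, a n • mFourierLp 2 n : L2 d)‖ ^ 2 : ℝ) : ℂ) =
      ((∑ n ∈ S, ‖a n‖ ^ 2 : ℝ) : ℂ) := by
    push_cast
    refine h.trans (Finset.sum_congr rfl fun n _ => ?_)
    rw [Complex.conj_mul']
  exact_mod_cast h2

lemma sq_eLpNorm_trigPoly {d : ℕ} (S : Finset (Fin d → ℤ)) (a : (Fin d → ℤ) → ℂ) :
    eLpNorm (fun x => ∑ n ∈ S, a n * mFourier n x) 2 volume ^ 2 = ∑ n ∈ S, ‖a n‖ₑ ^ 2 := by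
  rw [← eLpNorm_congr_ae (sum_smul_mFourierLp_ae_eq S a), ← Lp.enorm_def, ← ofReal_norm,
    ← ENNReal.ofReal_pow (norm_nonneg _), sq_norm_sum_smul_mFourierLp,
    ENNReal.ofReal_sum_of_nonneg fun _ _ => by positivity]
  refine Finset.sum_congr rfl fun n _ => ?_
  rw [ENNReal.ofReal_pow (norm_nonneg _), ofReal_norm]

/-! ### Products of three trigonometric polynomials -/

lemma sum_ite_sub_mem_eq {G E : Type*} [AddCommGroup G] [DecidableEq G] [AddCommMonoid E]
    {S R : Finset G} {w : G} (hw : ∀ n ∈ S, n + w ∈ R) (f : G → E) :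
    ∑ k ∈ R, (if k - w ∈ S then f k else 0) = ∑ n ∈ S, f (n + w) := by
  rw [← Finset.sum_filter]
  refine Finset.sum_nbij' (· - w) (· + w) ?_ ?_ ?_ ?_ ?_
  · intro k hk; exact (Finset.mem_filter.1 hk).2
  · intro n hn; simpa using ⟨hw n hn, hn⟩
  · intro k _; simp
  · intro n _; simp
  · intro k _; simp

open Classical in
/-- The frequencies `n + z₁ + z₂` with `n ∈ S`, `z₁ ∈ S₁`, `z₂ ∈ S₂`. -/
def sumFreq {d : ℕ} (S S₁ S₂ : Finset (Fin d → ℤ)) : Finset (Fin d → ℤ) :=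
  (S ×ˢ (S₁ ×ˢ S₂)).image fun w => w.1 + (w.2.1 + w.2.2)

open Classical in
/-- The coefficients of the product of three trigonometric polynomials before summation over
the pairs `z = (z₁, z₂)`. -/
def prodCoeff {d : ℕ} (S : Finset (Fin d → ℤ)) (a b c : (Fin d → ℤ) → ℂ) (k : Fin d → ℤ)
    (z : (Fin d → ℤ) × (Fin d → ℤ)) : ℂ :=
  if k - (z.1 + z.2) ∈ S then a (k - (z.1 + z.2)) * b z.1 * c z.2 else 0

lemma add_mem_sumFreq {d : ℕ} {S S₁ S₂ : Finset (Fin d → ℤ)}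
    {z : (Fin d → ℤ) × (Fin d → ℤ)} (hz : z ∈ S₁ ×ˢ S₂) :
    ∀ n ∈ S, n + (z.1 + z.2) ∈ sumFreq S S₁ S₂ := by
  classical
  intro n hn
  exact Finset.mem_image.2 ⟨(n, z), Finset.mem_product.2 ⟨hn, hz⟩, rfl⟩

lemma trigPoly_mul_mul {d : ℕ} (S S₁ S₂ : Finset (Fin d → ℤ)) (a b c : (Fin d → ℤ) → ℂ)
    (x : UnitAddTorus (Fin d)) :
    (∑ n ∈ S, a n * mFourier n x) * (∑ n ∈ S₁, b n * mFourier n x) *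
        (∑ n ∈ S₂, c n * mFourier n x) =
      ∑ k ∈ sumFreq S S₁ S₂, (∑ z ∈ S₁ ×ˢ S₂, prodCoeff S a b c k z) * mFourier k x := by
  classical
  simp_rw [Finset.sum_mul]
  rw [Finset.sum_comm]
  simp_rw [prodCoeff, ite_mul, zero_mul]
  have : ∀ z ∈ S₁ ×ˢ S₂, (∑ k ∈ sumFreq S S₁ S₂, if k - (z.1 + z.2) ∈ S then
      a (k - (z.1 + z.2)) * b z.1 * c z.2 * mFourier k x else 0) =
      (∑ n ∈ S, a n * mFourier n x) * (b z.1 * mFourier z.1 x) * (c z.2 * mFourier z.2 x) := by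
    intro z hz
    rw [sum_ite_sub_mem_eq (add_mem_sumFreq hz), Finset.sum_mul, Finset.sum_mul]
    refine Finset.sum_congr rfl fun n _ => ?_
    rw [add_sub_cancel_right, mFourier_add, mFourier_add]
    ring
  rw [Finset.sum_congr rfl this, Finset.sum_product]
  simp_rw [← Finset.mul_sum, ← Finset.sum_mul, ← Finset.mul_sum]

/-- For fixed `z`, the translation `k ↦ k - (z₁ + z₂)` matches the nonzero terms with `S`, so the
identity is exact whatever the size of `S`. -/
lemma sum_sum_sq_norm_prodCoeff {d : ℕ} (S S₁ S₂ : Finset (Fin d → ℤ))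
    (a b c : (Fin d → ℤ) → ℂ) :
    ∑ k ∈ sumFreq S S₁ S₂, ∑ z ∈ S₁ ×ˢ S₂, ‖prodCoeff S a b c k z‖ ^ 2 =
      (∑ n ∈ S, ‖a n‖ ^ 2) * (∑ n ∈ S₁, ‖b n‖ ^ 2) * ∑ n ∈ S₂, ‖c n‖ ^ 2 := by
  classical
  rw [Finset.sum_comm]
  have : ∀ z ∈ S₁ ×ˢ S₂, ∑ k ∈ sumFreq S S₁ S₂, ‖prodCoeff S a b c k z‖ ^ 2 =
      (∑ n ∈ S, ‖a n‖ ^ 2) * ‖b z.1‖ ^ 2 * ‖c z.2‖ ^ 2 := by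
    intro z hz
    have e : ∀ k, ‖prodCoeff S a b c k z‖ ^ 2 = if k - (z.1 + z.2) ∈ S then
        ‖a (k - (z.1 + z.2)) * b z.1 * c z.2‖ ^ 2 else 0 := by
      intro k
      rw [prodCoeff]
      split_ifs <;> simp
    simp_rw [e]
    rw [sum_ite_sub_mem_eq (add_mem_sumFreq hz), Finset.sum_mul, Finset.sum_mul]
    refine Finset.sum_congr rfl fun n _ => ?_
    rw [add_sub_cancel_right, norm_mul, norm_mul]
    ring
  rw [Finset.sum_congr rfl this, Finset.sum_product]
  simp_rw [← Finset.mul_sum, ← Finset.sum_mul, ← Finset.mul_sum]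

/-- The phase of the pair of frequencies `z` in the coefficient of frequency `k`. -/
def phase {d : ℕ} (α : Fin d → ℝ) (k : Fin d → ℤ) (z : (Fin d → ℤ) × (Fin d → ℤ)) : ℝ :=
  Q α (k - (z.1 + z.2)) + Q α z.1 + Q α z.2

lemma prodCoeff_expi_mul {d : ℕ} (α : Fin d → ℝ) (t : ℝ) (S : Finset (Fin d → ℤ))
    (a b c : (Fin d → ℤ) → ℂ) (k : Fin d → ℤ) (z : (Fin d → ℤ) × (Fin d → ℤ)) :
    prodCoeff S (fun n => expi (Q α n * t) * a n) (fun n => expi (Q α n * t) * b n)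
        (fun n => expi (Q α n * t) * c n) k z =
      prodCoeff S a b c k z * expi (phase α k z * t) := by
  rw [prodCoeff, prodCoeff]
  split_ifs
  · rw [phase, add_mul, add_mul, expi_add, expi_add]; ring
  · simp

/-! ### The trilinear estimate -/

/-- Sums and differences of points from two boxes of radius `3M` deviate by at most `6M` from their
centres; `2 ^ J` exceeds the width `2R` of the resulting integer range. -/
lemma exists_two_pow_between {M : ℝ} (hM : 1 ≤ M) :
    ∃ (R J : ℕ), 2 * R < 2 ^ J ∧ (∀ n : ℤ, |(n : ℝ)| ≤ 6 * M → |n| ≤ R) ∧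
      (2 : ℝ) ^ J ≤ 24 * M := by
  set R := ⌊6 * M⌋₊ with hR
  have hR1 : 1 ≤ R := Nat.le_floor (by push_cast; linarith)
  have hRM : (R : ℝ) ≤ 6 * M := Nat.floor_le (by linarith)
  refine ⟨R, Nat.log 2 (2 * R) + 1, Nat.lt_pow_succ_log_self (by norm_num) _, ?_, ?_⟩
  · intro n hn
    have : n.natAbs ≤ R := Nat.le_floor (by rwa [Nat.cast_natAbs, Int.cast_abs])
    rw [Int.abs_eq_natAbs]
    exact_mod_cast this
  · have h1 : 2 ^ Nat.log 2 (2 * R) ≤ 2 * R := Nat.pow_log_le_self 2 (by omega)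
    have h2 : (2 : ℝ) ^ Nat.log 2 (2 * R) ≤ 2 * R := by exact_mod_cast h1
    rw [pow_succ]
    linarith

/-- With `u = z₁ - z₂` and `v = z₁ + z₂`, each coordinate of the phase is `α ((k - v)² + (u² + v²) /
2)`. The pairs `(u, v)` fill only the part of the box with equal parities; injectivity suffices,
because the duality bound permits enlarging to the full box, where the kernel factors. -/
theorem sq_eLpNorm_sum_expi_phase_le {p b : ℝ} (hp : 2 < p) (hb : 0 < b) :
    ∃ c : ℝ, 0 < c ∧ ∀ α : Fin 2 → ℝ, (∀ i, b ≤ α i) → ∀ M : ℝ, 1 ≤ M →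
      ∀ (S₁ S₂ : Finset (Fin 2 → ℤ)) (c₁ c₂ : Fin 2 → ℤ),
      (∀ n ∈ S₁, ∀ i, |(n i : ℝ) - c₁ i| ≤ 3 * M) →
      (∀ n ∈ S₂, ∀ i, |(n i : ℝ) - c₂ i| ≤ 3 * M) →
      ∀ (k : Fin 2 → ℤ) (a : (Fin 2 → ℤ) × (Fin 2 → ℤ) → ℂ),
      eLpNorm (fun t => ∑ z ∈ S₁ ×ˢ S₂, a z * expi (phase α k z * t)) (ENNReal.ofReal p)
        (volume.restrict (Set.Icc (0 : ℝ) 1)) ^ 2 ≤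
      ENNReal.ofReal ((∑ z ∈ S₁ ×ˢ S₂, ‖a z‖ ^ 2) * (c * M ^ (4 - 4 / p))) := by
  obtain ⟨c, hc, hK⟩ := eLpNorm_weyl_kernel_le hp hb
  have hp0 : 0 < p := by linarith
  have hexp : 0 ≤ 4 - 4 / p := by
    rw [sub_nonneg, div_le_iff₀ hp0]; linarith
  refine ⟨c * 24 ^ (4 - 4 / p), by positivity, ?_⟩
  intro α hα M hM S₁ S₂ c₁ c₂ h₁ h₂ k a
  obtain ⟨R, J, hRJ, hR, hJ⟩ := exists_two_pow_between hM
  set A : Fin 2 → ℤ := fun i => c₁ i - c₂ i - R with hA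
  set B : Fin 2 → ℤ := fun i => c₁ i + c₂ i - R with hB
  let φ : (Fin 2 → ℤ) × (Fin 2 → ℤ) → (Fin 2 × Bool → ℕ) := fun z j =>
    if j.2 then (z.1 j.1 - z.2 j.1 - A j.1).toNat else (z.1 j.1 + z.2 j.1 - B j.1).toNat
  -- Coefficients after substituting `u = r + A` and `v = r + B`. The doubled leading ones are `α`
  -- and `3α`, bounded below by `b` uniformly in `k` and in the boxes.
  let θ : Fin 2 × Bool → ℝ := fun j => if j.2 then α j.1 / 2 else 3 * α j.1 / 2
  let ξ : Fin 2 × Bool → ℝ := fun j =>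
    if j.2 then α j.1 * A j.1 else α j.1 * (3 * B j.1 - 2 * k j.1)
  let η : Fin 2 × Bool → ℝ := fun j =>
    if j.2 then α j.1 * (A j.1 : ℝ) ^ 2 / 2
    else α j.1 * (3 * (B j.1 : ℝ) ^ 2 / 2 - 2 * k j.1 * B j.1 + (k j.1 : ℝ) ^ 2)
  have hrange : ∀ z ∈ S₁ ×ˢ S₂, ∀ i,
      (0 ≤ z.1 i - z.2 i - A i ∧ z.1 i - z.2 i - A i < 2 ^ J) ∧
      (0 ≤ z.1 i + z.2 i - B i ∧ z.1 i + z.2 i - B i < 2 ^ J) := by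
    intro z hz i
    obtain ⟨hz1, hz2⟩ := Finset.mem_product.1 hz
    have b1 := abs_le.1 (h₁ _ hz1 i)
    have b2 := abs_le.1 (h₂ _ hz2 i)
    have d1 := abs_le.1 (hR (z.1 i - z.2 i - (c₁ i - c₂ i)) (by
      push_cast; rw [abs_le]; constructor <;> linarith [b1.1, b1.2, b2.1, b2.2]))
    have d2 := abs_le.1 (hR (z.1 i + z.2 i - (c₁ i + c₂ i)) (by
      push_cast; rw [abs_le]; constructor <;> linarith [b1.1, b1.2, b2.1, b2.2]))
    have hRJ' : 2 * (R : ℤ) < 2 ^ J := by exact_mod_cast hRJ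
    simp only [hA, hB]
    refine ⟨⟨?_, ?_⟩, ?_, ?_⟩ <;> linarith [d1.1, d1.2, d2.1, d2.2]
  have hφtrue : ∀ z ∈ S₁ ×ˢ S₂, ∀ i, ((φ z (i, true) : ℕ) : ℤ) = z.1 i - z.2 i - A i :=
    fun z hz i => Int.toNat_of_nonneg (hrange z hz i).1.1
  have hφfalse : ∀ z ∈ S₁ ×ˢ S₂, ∀ i, ((φ z (i, false) : ℕ) : ℤ) = z.1 i + z.2 i - B i :=
    fun z hz i => Int.toNat_of_nonneg (hrange z hz i).2.1
  have hinj : Set.InjOn φ (S₁ ×ˢ S₂ : Finset _) := by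
    intro z hz w hw hzw
    have e : ∀ i, z.1 i = w.1 i ∧ z.2 i = w.2 i := by
      intro i
      have t1 := hφtrue z hz i
      have t2 := hφtrue w hw i
      have t3 := hφfalse z hz i
      have t4 := hφfalse w hw i
      rw [hzw] at t1 t3
      omega
    exact Prod.ext (funext fun i => (e i).1) (funext fun i => (e i).2)
  have hmaps : ∀ z ∈ S₁ ×ˢ S₂,
      φ z ∈ Fintype.piFinset fun _ : Fin 2 × Bool => Finset.range (2 ^ J) := by
    intro z hz
    rw [Fintype.mem_piFinset]
    rintro ⟨i, s⟩
    rw [Finset.mem_range]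
    zify
    cases s
    · rw [hφfalse z hz i]; exact (hrange z hz i).2.2
    · rw [hφtrue z hz i]; exact (hrange z hz i).1.2
  have hphase : ∀ z ∈ S₁ ×ˢ S₂, phase α k z =
      ∑ j, (θ j * (φ z j : ℝ) ^ 2 + ξ j * φ z j + η j) := by
    intro z hz
    have r1 : ∀ i, (φ z (i, true) : ℝ) = z.1 i - z.2 i - A i := fun i => by
      exact_mod_cast congrArg (Int.cast (R := ℝ)) (hφtrue z hz i)
    have r2 : ∀ i, (φ z (i, false) : ℝ) = z.1 i + z.2 i - B i := fun i => by
      exact_mod_cast congrArg (Int.cast (R := ℝ)) (hφfalse z hz i)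
    rw [Fintype.sum_prod_type, phase, Q, Q, Q, ← Finset.sum_add_distrib, ← Finset.sum_add_distrib]
    refine Finset.sum_congr rfl fun i _ => ?_
    rw [Fintype.sum_bool, r1, r2]
    simp only [θ, ξ, η, if_true, Bool.false_eq_true, if_false, Pi.sub_apply, Pi.add_apply]
    push_cast
    ring
  have hθ : ∀ j, b ≤ 2 * θ j := by
    rintro ⟨i, s⟩
    have := hα i
    cases s
    · simp only [θ, Bool.false_eq_true, if_false]; linarith
    · simp only [θ, if_true]; linarith
  have e1 : (fun t => ∑ z ∈ S₁ ×ˢ S₂, a z * expi (phase α k z * t)) = fun t =>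
      ∑ z ∈ S₁ ×ˢ S₂, a z * expi ((∑ j, (θ j * (φ z j : ℝ) ^ 2 + ξ j * φ z j + η j)) * t) := by
    ext t
    exact Finset.sum_congr rfl fun z hz => by rw [hphase z hz]
  rw [e1]
  refine (sq_eLpNorm_expi_sum_le hp (S₁ ×ˢ S₂) _ φ hinj hmaps a
    (fun r => ∑ j, (θ j * (r j : ℝ) ^ 2 + ξ j * r j + η j))).trans ?_
  rw [ENNReal.ofReal_mul (Finset.sum_nonneg fun _ _ => by positivity)]
  gcongr
  refine (hK J θ ξ η hθ).trans (ENNReal.ofReal_le_ofReal ?_)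
  rw [mul_assoc, ← Real.mul_rpow (by norm_num) (by linarith)]
  gcongr

/-- Minkowski's inequality for the `ℓ²` norm of a finite family of functions. -/
lemma sq_eLpNorm_le_sum_sq_eLpNorm {ι X E : Type*} [MeasurableSpace X] [NormedAddCommGroup E]
    {μ : Measure X} {p : ℝ} (hp : 2 ≤ p) (s : Finset ι) (Φ : X → ℝ≥0∞) (F : ι → X → E)
    (hF : ∀ i ∈ s, AEStronglyMeasurable (F i) μ) (hΦ : ∀ t, Φ t ^ 2 = ∑ i ∈ s, ‖F i t‖ₑ ^ 2) :
    eLpNorm Φ (ENNReal.ofReal p) μ ^ 2 ≤ ∑ i ∈ s, eLpNorm (F i) (ENNReal.ofReal p) μ ^ 2 := by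
  -- Squaring turns the claim into the triangle inequality in `L^{p/2}`, where `p / 2 ≥ 1`.
  have hpp : ENNReal.ofReal (p / 2) * ENNReal.ofReal 2 = ENNReal.ofReal p := by
    rw [← ENNReal.ofReal_mul (by positivity)]; congr 1; ring
  have h1p : 1 ≤ ENNReal.ofReal (p / 2) := by
    rw [← ENNReal.ofReal_one]; exact ENNReal.ofReal_le_ofReal (by linarith)
  have e1 := eLpNorm_enorm_rpow (p := ENNReal.ofReal (p / 2)) (μ := μ) Φ two_pos
  have e2 : ∀ i, eLpNorm (fun t => ‖F i t‖ₑ ^ (2 : ℝ)) (ENNReal.ofReal (p / 2)) μ =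
      eLpNorm (F i) (ENNReal.ofReal p) μ ^ 2 := fun i => by
    rw [eLpNorm_enorm_rpow _ two_pos, hpp, ENNReal.rpow_ofNat]
  rw [hpp, ENNReal.rpow_ofNat] at e1
  rw [← e1]
  simp_rw [← e2]
  have e3 : (fun t => ‖Φ t‖ₑ ^ (2 : ℝ)) = ∑ i ∈ s, fun t => ‖F i t‖ₑ ^ (2 : ℝ) := by
    ext t
    simp only [enorm_eq_self, ENNReal.rpow_ofNat, hΦ, Finset.sum_apply]
  rw [e3]
  exact eLpNorm_sum_le (fun i hi => ((hF i hi).enorm.pow_const _).aestronglyMeasurable) h1p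

end

end IrrationalTorus

/-! ### Summation over output frequencies -/

theorem mainTheorem4 (C p : ℝ) (hC : 0 < C) (hp : 2 < p) (hp' : p ≤ 4)
    (τ₀ : Set ℝ) (hτ : τ₀.OrdConnected) (hτ₀ : τ₀ ⊆ Set.Icc 0 1) :
    ∃ c : ℝ, 0 < c ∧
      ∀ α : Fin 2 → ℝ, (∀ j, 1 / C < α j ∧ α j < C) →
      ∀ N M : ℝ, 1 ≤ M → M ≤ N →
      ∀ 𝒞 : Fin 3 → Set (Fin 2 → ℤ),
        𝒞 0 ∈ IrrationalTorus.cubes 2 N →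
        𝒞 1 ∈ IrrationalTorus.cubes 2 M →
        𝒞 2 ∈ IrrationalTorus.cubes 2 M →
      ∀ φ : Fin 3 → IrrationalTorus.L2 2,
        IrrationalTorus.mixedNorm (ENNReal.ofReal p) τ₀
            (fun t x => ∏ j : Fin 3,
              IrrationalTorus.freqProj (𝒞 j) (IrrationalTorus.schrodinger α t (φ j)) x) ≤
          ENNReal.ofReal (c * M ^ (2 - 2 / p) *
            ∏ j : Fin 3, ‖IrrationalTorus.freqProj (𝒞 j) (φ j)‖) := by
  open IrrationalTorus in
  have hC' : 0 < 1 / C := by positivity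
  obtain ⟨c, hc, hmain⟩ := sq_eLpNorm_sum_expi_phase_le hp hC'
  refine ⟨Real.sqrt c, Real.sqrt_pos.2 hc, ?_⟩
  intro α hα N M hM hMN 𝒞 h0 h1 h2 φ
  have hfin : ∀ j, (𝒞 j).Finite := by
    intro j
    fin_cases j
    · exact finite_of_mem_cubes (by linarith) h0
    · exact finite_of_mem_cubes (by linarith) h1
    · exact finite_of_mem_cubes (by linarith) h2
  obtain ⟨c₁, hc₁⟩ := exists_center_of_mem_cubes (by linarith) h1
  obtain ⟨c₂, hc₂⟩ := exists_center_of_mem_cubes (by linarith) h2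
  set S : Fin 3 → Finset (Fin 2 → ℤ) := fun j => (hfin j).toFinset with hS
  have hS𝒞 : ∀ j, 𝒞 j = (S j : Set (Fin 2 → ℤ)) := fun j => by simp [hS]
  set a : Fin 3 → (Fin 2 → ℤ) → ℂ := fun j n => mFourierCoeff (φ j) n with ha
  -- `F k t` is the spatial Fourier coefficient at `k` of the product at time `t`.
  set F : (Fin 2 → ℤ) → ℝ → ℂ := fun k t =>
    ∑ z ∈ S 1 ×ˢ S 2, prodCoeff (S 0) (a 0) (a 1) (a 2) k z * expi (phase α k z * t) with hF
  have hx : ∀ t, eLpNorm (fun x => ∏ j : Fin 3, freqProj (𝒞 j) (schrodinger α t (φ j)) x) 2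
      volume ^ 2 = ∑ k ∈ sumFreq (S 0) (S 1) (S 2), ‖F k t‖ₑ ^ 2 := by
    intro t
    have hj : ∀ j, freqProj (𝒞 j) (schrodinger α t (φ j)) =ᵐ[volume]
        fun x => ∑ n ∈ S j, (expi (Q α n * t) * a j n) * mFourier n x := by
      intro j
      rw [hS𝒞 j, freqProj_coe_finset]
      simp_rw [mFourierCoeff_schrodinger]
      exact sum_smul_mFourierLp_ae_eq _ _
    have hprod : (fun x => ∏ j : Fin 3, freqProj (𝒞 j) (schrodinger α t (φ j)) x) =ᵐ[volume]
        fun x => ∑ k ∈ sumFreq (S 0) (S 1) (S 2), F k t * mFourier k x := by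
      filter_upwards [hj 0, hj 1, hj 2] with x x0 x1 x2
      rw [Fin.prod_univ_three, x0, x1, x2, trigPoly_mul_mul]
      simp_rw [prodCoeff_expi_mul, hF]
    rw [eLpNorm_congr_ae hprod, sq_eLpNorm_trigPoly]
  have hnorm : ∀ j, ∑ n ∈ S j, ‖a j n‖ ^ 2 = ‖freqProj (𝒞 j) (φ j)‖ ^ 2 := fun j => by
    rw [hS𝒞 j, freqProj_coe_finset, sq_norm_sum_smul_mFourierLp]
  have hsq : mixedNorm (ENNReal.ofReal p) τ₀ (fun t x => ∏ j : Fin 3,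
      freqProj (𝒞 j) (schrodinger α t (φ j)) x) ^ 2 ≤
      ENNReal.ofReal ((Real.sqrt c * M ^ (2 - 2 / p) *
        ∏ j : Fin 3, ‖freqProj (𝒞 j) (φ j)‖) ^ 2) := by
    rw [mixedNorm]
    refine (pow_le_pow_left' (eLpNorm_mono_measure _ (Measure.restrict_mono hτ₀ le_rfl)) 2).trans ?_
    refine (sq_eLpNorm_le_sum_sq_eLpNorm hp.le _ _ F (fun k _ => ?_) hx).trans ?_
    · exact (by fun_prop : Continuous (F k)).aestronglyMeasurable
    -- The bound for a single `k` depends on `k` only through the `ℓ²` mass of its coefficients, so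
    -- the masses can be summed.
    refine (Finset.sum_le_sum fun k _ => hmain α (fun i => (hα i).1.le) M hM (S 1) (S 2) c₁ c₂
      (fun n hn => hc₁ n (by rw [hS𝒞 1]; exact hn))
      (fun n hn => hc₂ n (by rw [hS𝒞 2]; exact hn)) k _).trans ?_
    rw [← ENNReal.ofReal_sum_of_nonneg fun k _ => by positivity, ← Finset.sum_mul,
      sum_sum_sq_norm_prodCoeff, hnorm, hnorm, hnorm, Fin.prod_univ_three]
    refine ENNReal.ofReal_le_ofReal (le_of_eq ?_)
    have e1 : M ^ (4 - 4 / p) = (M ^ (2 - 2 / p)) ^ 2 := by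
      rw [← Real.rpow_natCast, ← Real.rpow_mul (by linarith)]
      congr 1; push_cast; ring
    rw [e1, mul_pow, mul_pow, Real.sq_sqrt hc.le]
    ring
  rw [ENNReal.ofReal_pow (by positivity)] at hsq
  exact (ENNReal.pow_le_pow_left_iff two_ne_zero).1 hsq
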